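/- Let $M$ be a smooth manifold of dimension $n$ with a transversely holomorphic foliation $\mathcal F$ of complex codimension $r$: there are an open cover $(U_i)$ of $M$, a complex manifold $T$ of dimension $r$, smooth submersions $f_i:U_i\to T$ with connected fibres (the plaques of $\mathcal F$), and biholomorphisms $\gamma_{ij}$ between open subsets of $T$ with $f_j=\gamma_{ij}\circ f_i$ on $U_i\cap U_j$. A smooth complex-valued form $\alpha$ on $M$ is basic if $i_X\alpha=i_Xd\alpha=0$ for all $X$ tangent to the leaves. The complex structure which the $f_i$ induce on the normal bundle of $\mathcal F$ decomposes the space $\Omega^k(M/\mathcal F,\mathbb C)$ of basic $k$-forms as $\bigoplus_{p+q=k}\Omega^{p,q}(M/\mathcal F,\mathbb C)$, and $d=\partial+\bar\partial$ on basic forms with $\partial,\bar\partial$ of bidegree $(1,0)$ and $(0,1)$. Let $H^k(M/\mathcal F,\mathbb C)=\ker d/\operatorname{im}d$ be the basic cohomology and let $$H^{\bullet,\bullet}_{\bar\partial}(M/\mathcal F)=\frac{\ker\bar\partial}{\operatorname{im}\bar\partial},\qquad H^{\bullet,\bullet}_{BC}(M/\mathcal F)=\frac{\ker\partial\cap\ker\bar\partial}{\operatorname{im}\partial\bar\partial},\qquad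 H^{\bullet,\bullet}_{A}(M/\mathcal F)=\frac{\ker\partial\bar\partial}{\operatorname{im}\partial+\operatorname{im}\bar\partial}$$ be the basic Dolbeault, Bott–Chern and Aeppli cohomologies. Assume that $H^{p,q}_{\bar\partial}(M/\mathcal F)$ is finite-dimensional for all $p,q$. Then for every $k\in\mathbb N$ $$\sum_{p+q=k}\bigl(\dim_{\mathbb C}H^{p,q}_{BC}(M/\mathcal F)+\dim_{\mathbb C}H^{p,q}_{A}(M/\mathcal F)\bigr)\ \ge\ 2\dim_{\mathbb C}H^k(M/\mathcal F,\mathbb C).$$ Moreover, equality holds for every $k\in\mathbb N$ if and only if $\mathcal F$ satisfies the $\partial\bar\partial$-lemma, that is, $\ker\partial\cap\ker\bar\partial\cap\operatorname{im}d=\operatorname{im}\partial\bar\partial$ in $\Omega^{\bullet}(M/\mathcal F,\mathbb C)$. -/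

import Mathlib

open scoped Manifold ContDiff Topology

noncomputable section

namespace BasicForms

section NormedSpaces
variable {E F : Type*} [NormedAddCommGroup E] [NormedSpace ℝ E]
  [NormedAddCommGroup F] [NormedSpace ℝ F] {k : ℕ}

lemma exists_leftInverse_toMultilinear (E : Type*) [NormedAddCommGroup E] [NormedSpace ℝ E]
    [FiniteDimensional ℝ E] (k : ℕ) :
    ∃ L : ContinuousMultilinearMap ℝ (fun _ : Fin k => E) ℂ →L[ℝ] (E [⋀^Fin k]→L[ℝ] ℂ),
      ∀ a : E [⋀^Fin k]→L[ℝ] ℂ, L a.toContinuousMultilinearMap = a := by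
  have : FiniteDimensional ℝ (ContinuousMultilinearMap ℝ (fun _ : Fin k => E) ℂ) :=
    FiniteDimensional.of_injective
      (ContinuousMultilinearMap.toMultilinearMapLinear :
        ContinuousMultilinearMap ℝ (fun _ : Fin k => E) ℂ →ₗ[ℝ] _)
      ContinuousMultilinearMap.toMultilinearMap_injective
  obtain ⟨L, hL⟩ := LinearMap.exists_leftInverse_of_injective
    (ContinuousAlternatingMap.toContinuousMultilinearMapCLM ℝ :
      (E [⋀^Fin k]→L[ℝ] ℂ) →L[ℝ] _).toLinearMap
    (LinearMap.ker_eq_bot.2 ContinuousAlternatingMap.toContinuousMultilinearMap_injective)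
  exact ⟨LinearMap.toContinuousLinearMap L, fun a => LinearMap.congr_fun hL a⟩

lemma contDiffOn_pullback [FiniteDimensional ℝ E] {G : Type*} [NormedAddCommGroup G]
    [NormedSpace ℝ G] {b : G → F [⋀^Fin k]→L[ℝ] ℂ} {L : G → E →L[ℝ] F} {s : Set G}
    {r : WithTop ℕ∞} (hb : ContDiffOn ℝ r b s) (hL : ContDiffOn ℝ r L s) :
    ContDiffOn ℝ r (fun y => (b y).compContinuousLinearMap (L y)) s := by
  obtain ⟨A, hA⟩ := exists_leftInverse_toMultilinear E k
  have h1 : ContDiffOn ℝ r (fun y =>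
      (ContinuousMultilinearMap.compContinuousLinearMapContinuousMultilinear ℝ
        (fun _ : Fin k => E) (fun _ => F) ℂ (fun _ => L y))
        (ContinuousAlternatingMap.toContinuousMultilinearMapCLM ℝ (b y))) s := by
    refine ContDiffOn.clm_apply ?_ ?_
    · exact (ContinuousMultilinearMap.contDiff _).comp_contDiffOn
        (contDiffOn_pi.2 fun _ => hL)
    · exact (ContinuousLinearMap.contDiff _).comp_contDiffOn hb
  refine (A.contDiff.comp_contDiffOn h1).congr fun y hy => ?_
  exact (hA _).symm

lemma minSmoothness_two_le : minSmoothness ℝ 2 ≤ (∞ : WithTop ℕ∞) := by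
  rw [minSmoothness_of_isRCLikeNormedField]
  exact WithTop.coe_le_coe.2 (le_top : (2 : ℕ∞) ≤ ⊤)

lemma alternating_congr {V W : Type*} [AddCommGroup V] [Module ℝ V] [TopologicalSpace V]
    [AddCommGroup W] [Module ℝ W] (a : V [⋀^Fin k]→L[ℝ] ℂ) (l : V →ₗ[ℝ] W)
    (h : ∀ v : Fin k → V, (∃ j, l (v j) = 0) → a v = 0) (v w : Fin k → V)
    (hvw : ∀ j, l (v j) = l (w j)) : a v = a w := by
  classical
  have key : ∀ s : Finset (Fin k), a (s.piecewise v w) = a w := by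
    intro s
    induction s using Finset.induction_on with
    | empty => simp
    | insert i s hi ih =>
      rw [Finset.piecewise_insert, ← ih]
      have h1 : a (Function.update (s.piecewise v w) i (v i - w i)) = 0 := by
        refine h _ ⟨i, ?_⟩
        simp [hvw i]
      have h2 := a.map_update_add (s.piecewise v w) i (v i - w i) (w i)
      rw [h1, zero_add, sub_add_cancel] at h2
      rw [h2]
      congr 1
      ext j
      by_cases hj : j = i
      · subst hj; simp [hi]
      · simp [hj]
  simpa using key Finset.univ

lemma exists_local_descent [FiniteDimensional ℝ E] [FiniteDimensional ℝ F] {g : E → F}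
    {a : E → E [⋀^Fin k]→L[ℝ] ℂ} {W : Set E} (hW : IsOpen W) {y₀ : E} (hy₀ : y₀ ∈ W)
    (hg : ContDiffOn ℝ ∞ g W) (hs : ∀ y ∈ W, Function.Surjective (fderiv ℝ g y))
    (ha : ContDiffOn ℝ ∞ a W)
    (h0 : ∀ y ∈ W, ∀ v : Fin k → E, (∃ j, fderiv ℝ g y (v j) = 0) → a y v = 0)
    (h1 : ∀ y ∈ W, ∀ v : Fin (k + 1) → E, (∃ j, fderiv ℝ g y (v j) = 0) → extDeriv a y v = 0) :
    ∃ (b : F → F [⋀^Fin k]→L[ℝ] ℂ) (V : Set F) (W' : Set E), IsOpen V ∧ IsOpen W' ∧ y₀ ∈ W' ∧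
      W' ⊆ W ∧ Set.MapsTo g W' V ∧ ContDiffOn ℝ ∞ b V ∧
      ∀ y ∈ W', a y = (b (g y)).compContinuousLinearMap (fderiv ℝ g y) := by
  let K : Submodule ℝ E := (fderiv ℝ g y₀).ker
  obtain ⟨P, hP⟩ : ∃ P : E →L[ℝ] K, ∀ u : K, P u = u :=
    Submodule.ClosedComplemented.of_finiteDimensional_quotient
      (ContinuousLinearMap.isClosed_ker (fderiv ℝ g y₀))
  have hn : (∞ : WithTop ℕ∞) ≠ 0 := by simp
  let G : E → F × K := fun y => (g y, P y)
  have hGc : ContDiffOn ℝ ∞ G W := hg.prodMk P.contDiff.contDiffOn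
  have hgd : ∀ y ∈ W, HasFDerivAt g (fderiv ℝ g y) y := fun y hy =>
    ((hg.contDiffAt (hW.mem_nhds hy)).differentiableAt hn).hasFDerivAt
  have hGd : ∀ y ∈ W, HasFDerivAt G ((fderiv ℝ g y).prod P) y := fun y hy =>
    (hgd y hy).prodMk P.hasFDerivAt
  have hbij : Function.Bijective ((fderiv ℝ g y₀).prod P) := by
    constructor
    · refine (injective_iff_map_eq_zero _).2 fun v hv => ?_
      have hv' := Prod.ext_iff.1 hv
      have h3 : v ∈ K := hv'.1
      have h4 := hP ⟨v, h3⟩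
      have h5 : P v = 0 := hv'.2
      rw [h5] at h4
      exact (congrArg Subtype.val h4).symm
    · rintro ⟨t, u⟩
      obtain ⟨v, hv⟩ := hs y₀ hy₀ t
      refine ⟨v + ((u : E) - (P v : E)), Prod.ext ?_ ?_⟩
      · have e1 : fderiv ℝ g y₀ (u : E) = 0 := u.2
        have e2 : fderiv ℝ g y₀ (P v : E) = 0 := (P v).2
        simp [hv, e1, e2]
      · simp [hP]
  let e₀ : E ≃L[ℝ] F × K :=
    (LinearEquiv.ofBijective ((fderiv ℝ g y₀).prod P).toLinearMap hbij).toContinuousLinearEquiv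
  have he₀ : HasFDerivAt G (e₀ : E →L[ℝ] F × K) y₀ := by
    have : (e₀ : E →L[ℝ] F × K) = (fderiv ℝ g y₀).prod P := by ext v <;> rfl
    rw [this]
    exact hGd y₀ hy₀
  have hGc₀ : ContDiffAt ℝ ∞ G y₀ := hGc.contDiffAt (hW.mem_nhds hy₀)
  let φ := hGc₀.toOpenPartialHomeomorph G he₀ hn
  have hφ : ∀ y, φ y = G y := fun y => rfl
  have hφ0 : y₀ ∈ φ.source := hGc₀.mem_toOpenPartialHomeomorph_source he₀ hn
  have hcont : ContinuousOn (fun y => (fderiv ℝ g y).prod P) W := by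
    have h2 : ContinuousOn (fderiv ℝ G) W := hGc.continuousOn_fderiv_of_isOpen hW (by simp)
    exact h2.congr fun y hy => (hGd y hy).fderiv.symm
  let W₁ : Set E := (W ∩ (fun y => (fderiv ℝ g y).prod P) ⁻¹'
    (Set.range ((↑) : (E ≃L[ℝ] F × K) → E →L[ℝ] F × K))) ∩ φ.source
  have hW₁ : IsOpen W₁ :=
    (hcont.isOpen_inter_preimage hW ContinuousLinearEquiv.isOpen).inter φ.open_source
  have hy₁ : y₀ ∈ W₁ := ⟨⟨hy₀, e₀, by ext v <;> rfl⟩, hφ0⟩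
  have hW₁W : W₁ ⊆ W := fun y hy => hy.1.1
  have hopen : IsOpen (φ '' W₁) := φ.isOpen_image_of_subset_source hW₁ fun y hy => hy.2
  obtain ⟨ε, hε, hball⟩ := Metric.isOpen_iff.1 hopen (φ y₀) ⟨y₀, hy₁, rfl⟩
  set V : Set F := Metric.ball (g y₀) ε with hV
  set B : Set K := Metric.ball (P y₀) ε with hB
  have hVB : ∀ z : F × K, z.1 ∈ V → z.2 ∈ B → z ∈ φ '' W₁ := fun z hz1 hz2 => by
    apply hball
    have : z ∈ V ×ˢ B := ⟨hz1, hz2⟩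
    rw [hV, hB, ball_prod_same] at this
    exact this
  let O : Set (F × K) := V ×ˢ B
  have hO : IsOpen O := Metric.isOpen_ball.prod Metric.isOpen_ball
  let Ψ : F × K → E := φ.symm
  have hΨW : ∀ z ∈ O, Ψ z ∈ W₁ := by
    rintro z ⟨hz1, hz2⟩
    obtain ⟨y, hy, rfl⟩ := hVB z hz1 hz2
    change φ.symm (φ y) ∈ W₁
    rwa [φ.left_inv hy.2]
  have hGΨ : ∀ z ∈ O, G (Ψ z) = z := by
    rintro z ⟨hz1, hz2⟩
    obtain ⟨y, hy, rfl⟩ := hVB z hz1 hz2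
    exact φ.right_inv (φ.map_source hy.2)
  have hΨc : ∀ z ∈ O, ContDiffAt ℝ ∞ Ψ z := by
    intro z hz
    have hz' := hΨW z hz
    obtain ⟨e, he⟩ := hz'.1.2
    obtain ⟨y, hy, hyz⟩ := hVB z hz.1 hz.2
    refine φ.contDiffAt_symm (f₀' := e) (hyz ▸ φ.map_source hy.2) ?_ ?_
    · rw [he]
      exact hGd _ (hW₁W hz')
    · exact hGc.contDiffAt (hW.mem_nhds (hW₁W hz'))
  have hΨd : ∀ z ∈ O, HasFDerivAt Ψ (fderiv ℝ Ψ z) z := fun z hz =>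
    ((hΨc z hz).differentiableAt hn).hasFDerivAt
  have hcomp : ∀ z ∈ O, ∀ w : F × K,
      fderiv ℝ g (Ψ z) (fderiv ℝ Ψ z w) = w.1 ∧ P (fderiv ℝ Ψ z w) = w.2 := by
    intro z hz w
    have h2 := (hGd _ (hW₁W (hΨW z hz))).comp z (hΨd z hz)
    have h3 : HasFDerivAt (G ∘ Ψ) (ContinuousLinearMap.id ℝ (F × K)) z :=
      (hasFDerivAt_id z).congr_of_eventuallyEq
        (Filter.eventuallyEq_of_mem (hO.mem_nhds hz) hGΨ)
    have h4 := DFunLike.congr_fun (h2.unique h3) w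
    exact Prod.ext_iff.1 h4
  let a' : F × K → (F × K) [⋀^Fin k]→L[ℝ] ℂ := fun z =>
    (a (Ψ z)).compContinuousLinearMap (fderiv ℝ Ψ z)
  have hΨon : ContDiffOn ℝ ∞ Ψ O := fun z hz => (hΨc z hz).contDiffWithinAt
  have ha' : ContDiffOn ℝ ∞ a' O := by
    refine contDiffOn_pullback (ha.comp hΨon fun z hz => hW₁W (hΨW z hz)) ?_
    exact hΨon.fderiv_of_isOpen hO (by simp)
  have hvert0 : ∀ z ∈ O, ∀ v : Fin k → F × K, (∃ j, (v j).1 = 0) → a' z v = 0 := by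
    rintro z hz v ⟨j, hj⟩
    refine h0 _ (hW₁W (hΨW z hz)) _ ⟨j, ?_⟩
    exact (hcomp z hz (v j)).1.trans hj
  have hvert1 : ∀ z ∈ O, ∀ v : Fin (k + 1) → F × K, (∃ j, (v j).1 = 0) →
      extDeriv a' z v = 0 := by
    rintro z hz v ⟨j, hj⟩
    have h2 : extDeriv a' z = (extDeriv a (Ψ z)).compContinuousLinearMap (fderiv ℝ Ψ z) :=
      extDeriv_pullback (r := ∞)
        ((ha.contDiffAt (hW.mem_nhds (hW₁W (hΨW z hz)))).differentiableAt hn) (hΨc z hz)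
        minSmoothness_two_le
    rw [h2]
    refine h1 _ (hW₁W (hΨW z hz)) _ ⟨j, ?_⟩
    exact (hcomp z hz (v j)).1.trans hj
  have ha'd : ∀ z ∈ O, DifferentiableAt ℝ a' z := fun z hz =>
    (ha'.contDiffAt (hO.mem_nhds hz)).differentiableAt hn
  have hd : ∀ z ∈ O, ∀ (w : Fin k → F × K) (u : K),
      fderiv ℝ (fun z => a' z w) z (0, u) = 0 := by
    intro z hz w u
    have h2 := extDeriv_apply (ha'd z hz) (Fin.cons (0, u) w)
    rw [hvert1 z hz _ ⟨0, rfl⟩, Fin.sum_univ_succ] at h2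
    have h3 : ∀ i : Fin k, fderiv ℝ (fun z => a' z (i.succ.removeNth
        (Fin.cons ((0, u) : F × K) w : Fin (k + 1) → F × K))) z = 0 := by
      intro i
      have h4 : (fun z => a' z (i.succ.removeNth
          (Fin.cons ((0, u) : F × K) w : Fin (k + 1) → F × K))) =ᶠ[𝓝 z] fun _ => 0 := by
        refine Filter.eventuallyEq_of_mem (hO.mem_nhds hz) fun z' hz' => ?_
        refine hvert0 z' hz' _ ?_
        obtain ⟨m, rfl⟩ : ∃ m, k = m + 1 := ⟨k - 1, by have := i.2; omega⟩
        exact ⟨0, by simp [Fin.removeNth]⟩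
      rw [h4.fderiv_eq]
      simp
    simp only [h3] at h2
    simpa using h2.symm
  have hconst : ∀ z ∈ O, ∀ w : Fin k → F × K, a' z w = a' (z.1, P y₀) w := by
    intro z hz w
    have hin : ∀ u ∈ B, ((z.1, u) : F × K) ∈ O := fun u hu => ⟨hz.1, hu⟩
    have hdiff : ∀ u ∈ B, HasFDerivAt (fun u => a' (z.1, u) w)
        ((fderiv ℝ (fun z => a' z w) (z.1, u)).comp (ContinuousLinearMap.inr ℝ F K)) u := by
      intro u hu
      have h2 : DifferentiableAt ℝ (fun z => a' z w) (z.1, u) :=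
        (ha'd _ (hin u hu)).continuousAlternatingMap_apply_const w
      exact h2.hasFDerivAt.comp u (hasFDerivAt_prodMk_right z.1 u)
    have := Metric.isOpen_ball.is_const_of_fderiv_eq_zero (𝕜 := ℝ) (s := B)
      (f := fun u => a' (z.1, u) w) (convex_ball _ _).isPreconnected
      (fun u hu => (hdiff u hu).differentiableAt.differentiableWithinAt)
      (fun u hu => by
        rw [(hdiff u hu).fderiv]
        ext u'
        exact hd _ (hin u hu) w u') hz.2 (Metric.mem_ball_self hε)
    exact this
  refine ⟨fun t => (a' (t, P y₀)).compContinuousLinearMap (ContinuousLinearMap.inl ℝ F K), V,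
    W₁ ∩ φ ⁻¹' O, Metric.isOpen_ball, ?_, ⟨hy₁, Metric.mem_ball_self hε, Metric.mem_ball_self hε⟩,
    fun y hy => hW₁W hy.1, fun y hy => hy.2.1, ?_, ?_⟩
  · have hc : ContinuousOn φ W₁ := hGc.continuousOn.mono hW₁W
    exact hc.isOpen_inter_preimage hW₁ hO
  · refine contDiffOn_pullback ?_ contDiffOn_const
    refine ha'.comp (contDiff_id.prodMk contDiff_const).contDiffOn fun t ht => ?_
    exact ⟨ht, Metric.mem_ball_self hε⟩
  · rintro y ⟨hy, hyO⟩
    have hΨy : Ψ (G y) = y := φ.left_inv hy.2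
    have hyO' : G y ∈ O := hyO
    ext v
    have h2 := hconst (G y) hyO' (fun j => (fderiv ℝ g y (v j), 0))
    change a y v = a' ((G y).1, P y₀) (fun j => (fderiv ℝ g y (v j), 0))
    rw [← h2]
    change a y v = a (Ψ (G y)) (fun j => fderiv ℝ Ψ (G y) (fderiv ℝ g y (v j), 0))
    have h3 := fun j => (hcomp (G y) hyO' (fderiv ℝ g y (v j), 0)).1
    rw [hΨy] at h3 ⊢
    exact alternating_congr (a y) (fderiv ℝ g y).toLinearMap (h0 y (hW₁W hy)) _ _
      fun j => (h3 j).symm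
end NormedSpaces

section Manifolds
variable {E : Type*} [NormedAddCommGroup E] [NormedSpace ℝ E]
  {M : Type*} [TopologicalSpace M] [ChartedSpace E M] {k : ℕ}

/-- A (not necessarily smooth) complex valued `k`-form on the manifold `M` modelled on `E`. -/
def RawForm (E : Type*) [NormedAddCommGroup E] [NormedSpace ℝ E] (M : Type*)
    [TopologicalSpace M] [ChartedSpace E M] (k : ℕ) : Type _ :=
  (x : M) → TangentSpace 𝓘(ℝ, E) x [⋀^Fin k]→L[ℝ] ℂ

instance : AddCommGroup (RawForm E M k) := Pi.addCommGroup

instance : Module ℂ (RawForm E M k) :=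
  inferInstanceAs (Module ℂ ((x : M) → TangentSpace 𝓘(ℝ, E) x [⋀^Fin k]→L[ℝ] ℂ))

/-- The expression of a form in the preferred chart at `x₀`: the pullback of the form by the
inverse of the chart. -/
def chartRep (x₀ : M) (α : RawForm E M k) (y : E) : E [⋀^Fin k]→L[ℝ] ℂ :=
  ContinuousAlternatingMap.compContinuousLinearMap
    (M := TangentSpace 𝓘(ℝ, E) ((extChartAt 𝓘(ℝ, E) x₀).symm y))
    (α ((extChartAt 𝓘(ℝ, E) x₀).symm y))
    (mfderiv 𝓘(ℝ, E) 𝓘(ℝ, E) (extChartAt 𝓘(ℝ, E) x₀).symm y)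

/-- A form is smooth if its expressions in all charts are. -/
def IsSmooth (α : RawForm E M k) : Prop :=
  ∀ x₀ : M, ContDiffOn ℝ ∞ (chartRep x₀ α) (extChartAt 𝓘(ℝ, E) x₀).target

/-- The exterior derivative, computed at each point in the preferred chart at this point. -/
def extDerivForm (α : RawForm E M k) : RawForm E M (k + 1) := fun x =>
  ContinuousAlternatingMap.compContinuousLinearMap (M' := TangentSpace 𝓘(ℝ, E) x)
   (extDeriv (chartRep x α) (extChartAt 𝓘(ℝ, E) x x))
    (mfderiv 𝓘(ℝ, E) 𝓘(ℝ, E) (extChartAt 𝓘(ℝ, E) x) x)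

section
variable [IsManifold 𝓘(ℝ, E) ∞ M]

lemma mdiff_symm {x₀ : M} {y : E} (hy : y ∈ (extChartAt 𝓘(ℝ, E) x₀).target) :
    MDifferentiableAt 𝓘(ℝ, E) 𝓘(ℝ, E) (extChartAt 𝓘(ℝ, E) x₀).symm y :=
  ((contMDiffOn_extChartAt_symm (n := ∞) x₀).contMDiffAt
    ((isOpen_extChartAt_target x₀).mem_nhds hy)).mdifferentiableAt (by simp)

lemma mdiff_chart {x₀ x : M} (hx : x ∈ (extChartAt 𝓘(ℝ, E) x₀).source) :
    MDifferentiableAt 𝓘(ℝ, E) 𝓘(ℝ, E) (extChartAt 𝓘(ℝ, E) x₀) x :=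
  ((contMDiffOn_extChartAt (n := ∞)).contMDiffAt
    ((chartAt E x₀).open_source.mem_nhds (by simpa using hx))).mdifferentiableAt (by simp)

lemma contDiffAt_transition {x₀ x₁ : M} {y : E} (hy : y ∈ (extChartAt 𝓘(ℝ, E) x₀).target)
    (hy' : (extChartAt 𝓘(ℝ, E) x₀).symm y ∈ (extChartAt 𝓘(ℝ, E) x₁).source) :
    ContDiffAt ℝ ∞ (extChartAt 𝓘(ℝ, E) x₁ ∘ (extChartAt 𝓘(ℝ, E) x₀).symm) y := by
  rw [← contMDiffAt_iff_contDiffAt]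
  refine ContMDiffAt.comp y ?_ ((contMDiffOn_extChartAt_symm (n := ∞) x₀).contMDiffAt
    ((isOpen_extChartAt_target x₀).mem_nhds hy))
  exact (contMDiffOn_extChartAt (n := ∞)).contMDiffAt
    ((chartAt E x₁).open_source.mem_nhds (by simpa using hy'))

/-- Change of charts. -/
lemma chartRep_eventuallyEq (α : RawForm E M k) {x₀ x₁ : M} {y : E}
    (hy : y ∈ (extChartAt 𝓘(ℝ, E) x₀).target)
    (hy' : (extChartAt 𝓘(ℝ, E) x₀).symm y ∈ (extChartAt 𝓘(ℝ, E) x₁).source) :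
    chartRep x₀ α =ᶠ[𝓝 y] fun z =>
      (chartRep x₁ α ((extChartAt 𝓘(ℝ, E) x₁ ∘ (extChartAt 𝓘(ℝ, E) x₀).symm) z)).compContinuousLinearMap
        (fderiv ℝ (extChartAt 𝓘(ℝ, E) x₁ ∘ (extChartAt 𝓘(ℝ, E) x₀).symm) z) := by
  set c₀ := extChartAt 𝓘(ℝ, E) x₀
  set c₁ := extChartAt 𝓘(ℝ, E) x₁
  have hnear : ∀ᶠ z in 𝓝 y, z ∈ c₀.target ∧ c₀.symm z ∈ c₁.source := by
    refine Filter.Eventually.and ((isOpen_extChartAt_target x₀).eventually_mem hy) ?_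
    exact (mdiff_symm hy).continuousAt.preimage_mem_nhds
      ((isOpen_extChartAt_source x₁).mem_nhds hy')
  filter_upwards [hnear.eventually_nhds] with z hz
  have hz0 := hz.self_of_nhds
  have h1 : c₁.symm (c₁ (c₀.symm z)) = c₀.symm z := c₁.left_inv hz0.2
  have h2 : mfderiv 𝓘(ℝ, E) 𝓘(ℝ, E) c₀.symm z =
      (mfderiv 𝓘(ℝ, E) 𝓘(ℝ, E) c₁.symm ((c₁ ∘ c₀.symm) z)).comp
        (mfderiv 𝓘(ℝ, E) 𝓘(ℝ, E) (c₁ ∘ c₀.symm) z) := by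
    rw [← mfderiv_comp z (mdiff_symm (c₁.map_source hz0.2))
      ((mdiff_chart hz0.2).comp z (mdiff_symm hz0.1))]
    refine Filter.EventuallyEq.mfderiv_eq ?_
    filter_upwards [hz] with w hw
    exact (c₁.left_inv hw.2).symm
  ext v
  have key : ∀ (p : M) (hp : p = c₀.symm z) (A : E →L[ℝ] E),
      (∀ j, A (v j) = (mfderiv 𝓘(ℝ, E) 𝓘(ℝ, E) c₀.symm z : E →L[ℝ] E) (v j)) →
      α (c₀.symm z) (fun j => (mfderiv 𝓘(ℝ, E) 𝓘(ℝ, E) c₀.symm z : E →L[ℝ] E) (v j)) =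
        α p (fun j => A (v j)) := by
    rintro p rfl A hA
    simp only [hA]
  refine key _ h1 ((mfderiv 𝓘(ℝ, E) 𝓘(ℝ, E) c₁.symm ((c₁ ∘ c₀.symm) z)).comp
        (fderiv ℝ (c₁ ∘ c₀.symm) z)) fun j => ?_
  rw [h2, mfderiv_eq_fderiv]
  rfl

lemma chartRep_extDerivForm {α : RawForm E M k} (hα : IsSmooth α) {x₀ : M} {y : E}
    (hy : y ∈ (extChartAt 𝓘(ℝ, E) x₀).target) :
    chartRep x₀ (extDerivForm α) y = extDeriv (chartRep x₀ α) y := by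
  set x := (extChartAt 𝓘(ℝ, E) x₀).symm y with hx
  have hxs : x ∈ (extChartAt 𝓘(ℝ, E) x).source := mem_extChartAt_source x
  rw [(chartRep_eventuallyEq α hy hxs).extDeriv_eq,
    extDeriv_pullback (r := ∞) _ (contDiffAt_transition hy hxs) minSmoothness_two_le]
  · have h := mfderiv_comp y (mdiff_chart hxs) (mdiff_symm hy)
    rw [mfderiv_eq_fderiv] at h
    refine Eq.trans ?_ (congrArg (ContinuousAlternatingMap.compContinuousLinearMap
      (extDeriv (chartRep x α) (extChartAt 𝓘(ℝ, E) x x))) h.symm)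
    rfl
  · exact ((hα x).contDiffAt ((isOpen_extChartAt_target x).mem_nhds
      (mem_extChartAt_target x))).differentiableAt (by simp)

end

lemma chartRep_add (x₀ : M) (α β : RawForm E M k) :
    chartRep x₀ (α + β) = fun y => chartRep x₀ α y + chartRep x₀ β y := rfl

lemma chartRep_smul (x₀ : M) (c : ℂ) (α : RawForm E M k) :
    chartRep x₀ (c • α) = fun y => c • chartRep x₀ α y := rfl

lemma chartRep_zero (x₀ : M) : chartRep x₀ (0 : RawForm E M k) = fun _ => 0 := rfl

lemma IsSmooth.differentiableAt {α : RawForm E M k} (hα : IsSmooth α) (x : M) :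
    DifferentiableAt ℝ (chartRep x α) (extChartAt 𝓘(ℝ, E) x x) :=
  ((hα x).contDiffAt ((isOpen_extChartAt_target x).mem_nhds
    (mem_extChartAt_target x))).differentiableAt (by simp)

lemma extDerivForm_add {α β : RawForm E M k} (hα : IsSmooth α) (hβ : IsSmooth β) :
    extDerivForm (α + β) = extDerivForm α + extDerivForm β := by
  funext x
  unfold extDerivForm
  rw [chartRep_add, extDeriv_fun_add (hα.differentiableAt x) (hβ.differentiableAt x)]
  rfl

lemma extDerivForm_smul (c : ℂ) {α : RawForm E M k} (hα : IsSmooth α) :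
    extDerivForm (c • α) = c • extDerivForm α := by
  funext x
  have h : extDeriv (fun y => c • chartRep x α y) (extChartAt 𝓘(ℝ, E) x x) =
      c • extDeriv (chartRep x α) (extChartAt 𝓘(ℝ, E) x x) := by
    ext v
    have hd : ∀ w : Fin k → E, DifferentiableAt ℝ (fun y => chartRep x α y w)
        (extChartAt 𝓘(ℝ, E) x x) :=
      fun w => (hα.differentiableAt x).continuousAlternatingMap_apply_const w
    have h1 : DifferentiableAt ℝ (fun y => c • chartRep x α y) (extChartAt 𝓘(ℝ, E) x x) :=
      (hα.differentiableAt x).const_smul c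
    rw [extDeriv_apply h1,
      ContinuousAlternatingMap.smul_apply, extDeriv_apply (hα.differentiableAt x),
      Finset.smul_sum]
    refine Finset.sum_congr rfl fun i _ => ?_
    have h2 := fderiv_const_smul (hd (i.removeNth v)) c
    have h3 : (fun y => (c • chartRep x α y) (i.removeNth v)) =
      c • fun y => chartRep x α y (i.removeNth v) := rfl
    rw [h3, h2, smul_apply, smul_comm]
  unfold extDerivForm
  rw [chartRep_smul, h]
  rfl

lemma isSmooth_zero : IsSmooth (0 : RawForm E M k) := fun x₀ => by
  rw [chartRep_zero]
  exact contDiffOn_const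

lemma extDerivForm_zero : extDerivForm (0 : RawForm E M k) = 0 := by
  have h := extDerivForm_smul (0 : ℂ) (isSmooth_zero (E := E) (M := M) (k := k))
  rwa [zero_smul, zero_smul] at h

lemma IsSmooth.add {α β : RawForm E M k} (hα : IsSmooth α) (hβ : IsSmooth β) :
    IsSmooth (α + β) := fun x₀ => (hα x₀).add (hβ x₀)

lemma IsSmooth.smul (c : ℂ) {α : RawForm E M k} (hα : IsSmooth α) :
    IsSmooth (c • α) := fun x₀ => (hα x₀).const_smul c

section
variable [IsManifold 𝓘(ℝ, E) ∞ M]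

lemma IsSmooth.extDerivForm {α : RawForm E M k} (hα : IsSmooth α) :
    IsSmooth (extDerivForm α) := by
  intro x₀
  have h : ContDiffOn ℝ ∞ (extDeriv (chartRep x₀ α)) (extChartAt 𝓘(ℝ, E) x₀).target :=
    (ContinuousAlternatingMap.alternatizeUncurryFinCLM ℝ E ℂ).contDiff.comp_contDiffOn
      ((hα x₀).fderiv_of_isOpen (isOpen_extChartAt_target x₀) (by simp))
  exact h.congr fun y hy => chartRep_extDerivForm hα hy

lemma extDerivForm_extDerivForm {α : RawForm E M k} (hα : IsSmooth α) :
    BasicForms.extDerivForm (BasicForms.extDerivForm α) = 0 := by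
  funext x
  have h : extDeriv (chartRep x (BasicForms.extDerivForm α)) (extChartAt 𝓘(ℝ, E) x x) = 0 := by
    have h1 : chartRep x (BasicForms.extDerivForm α) =ᶠ[𝓝 (extChartAt 𝓘(ℝ, E) x x)]
        extDeriv (chartRep x α) :=
      Filter.eventuallyEq_of_mem ((isOpen_extChartAt_target x).mem_nhds
        (mem_extChartAt_target x)) fun y hy => chartRep_extDerivForm hα hy
    rw [h1.extDeriv_eq]
    exact extDeriv_extDeriv_apply ((hα x).contDiffAt ((isOpen_extChartAt_target x).mem_nhds
      (mem_extChartAt_target x))) minSmoothness_two_le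
  rw [BasicForms.extDerivForm, h]
  rfl
end
end Manifolds

section Foliations

/-- A transversely holomorphic foliation of the real manifold `M`, given by a cocycle of
submersions `f i : U i → T` with connected fibres into a complex manifold `T`,
any two of which differ by a biholomorphism `γ i j` between open subsets of `T`. (`T` plays the
role of the transverse manifold; it may be the disjoint union of the images `f i (U i)`.) The leaves are
the manifolds glued from the fibres of the `f i`. -/
structure TransverselyHolomorphicFoliation
    (E : Type*) [NormedAddCommGroup E] [NormedSpace ℝ E]
    (M : Type*) [TopologicalSpace M] [ChartedSpace E M]
    (F : Type*) [NormedAddCommGroup F] [NormedSpace ℂ F]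
    (T : Type*) [TopologicalSpace T] [ChartedSpace F T] (ι : Type*) where
  /-- The open cover. -/
  U : ι → Set M
  isOpen_U : ∀ i, IsOpen (U i)
  cover : ∀ x, ∃ i, x ∈ U i
  /-- The local submersions (only their values on `U i` matter). -/
  f : ι → M → T
  smooth_f : ∀ i, ContMDiffOn 𝓘(ℝ, E) 𝓘(ℝ, F) ∞ (f i) (U i)
  submersion_f : ∀ i, ∀ x ∈ U i, Function.Surjective (mfderiv 𝓘(ℝ, E) 𝓘(ℝ, F) (f i) x)
  connected_fibres : ∀ i t, IsPreconnected (U i ∩ f i ⁻¹' {t})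
  /-- The transition maps. -/
  γ : ι → ι → OpenPartialHomeomorph T T
  holomorphic_γ : ∀ i j, (γ i j).MDifferentiable 𝓘(ℂ, F) 𝓘(ℂ, F)
  mem_source_γ : ∀ i j, ∀ x ∈ U i ∩ U j, f i x ∈ (γ i j).source
  cocycle : ∀ i j, ∀ x ∈ U i ∩ U j, f j x = γ i j (f i x)

variable {E : Type*} [NormedAddCommGroup E] [NormedSpace ℝ E]
  {M : Type*} [TopologicalSpace M] [ChartedSpace E M]
  {F : Type*} [NormedAddCommGroup F] [NormedSpace ℂ F]
  {T : Type*} [TopologicalSpace T] [ChartedSpace F T] {ι : Type*} {k : ℕ}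

lemma isManifold_real [IsManifold 𝓘(ℂ, F) ω T] : IsManifold 𝓘(ℝ, F) ∞ T := by
  refine isManifold_of_contDiffOn _ _ _ fun e e' he he' => ?_
  have h := contDiffGroupoid ω 𝓘(ℂ, F) |>.compatible he he'
  have h1 : ContDiffOn ℂ ω (e.symm ≫ₕ e') ((e.symm ≫ₕ e').source ∩ Set.range id) := h.1
  exact (h1.restrict_scalars ℝ).of_le le_top

lemma HasMFDerivAt.real {T' : Type*} [TopologicalSpace T'] [ChartedSpace F T'] {φ : T → T'} {t : T} {L : F →L[ℂ] F}
    (h : HasMFDerivAt 𝓘(ℂ, F) 𝓘(ℂ, F) φ t L) :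
    HasMFDerivAt 𝓘(ℝ, F) 𝓘(ℝ, F) φ t (L.restrictScalars ℝ) :=
  ⟨h.1, HasFDerivWithinAt.restrictScalars ℝ h.2⟩

namespace TransverselyHolomorphicFoliation
variable (𝓕 : TransverselyHolomorphicFoliation E M F T ι)

/-- The differential of `f i` at `x`. For `x ∈ U i` its kernel is the tangent space of the leaf
through `x`, and it identifies the normal space of the leaf with the tangent space of the complex
manifold `T` at `f i x`, that is, with the complex vector space `F`. -/
def transDeriv (i : ι) (x : M) : TangentSpace 𝓘(ℝ, E) x →L[ℝ] F :=
  mfderiv 𝓘(ℝ, E) 𝓘(ℝ, F) (𝓕.f i) x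

/-- `α x` vanishes as soon as one of its arguments is tangent to the leaf through `x`. -/
def IsHorizontal (α : RawForm E M k) : Prop :=
  ∀ i, ∀ x ∈ 𝓕.U i, ∀ v : Fin k → TangentSpace 𝓘(ℝ, E) x,
    (∃ j, 𝓕.transDeriv i x (v j) = 0) → α x v = 0

/-- The complex vector space `Ω^k(M/𝓕, ℂ)` of complex valued basic `k`-forms: the smooth forms
`α` such that `i_X α = i_X dα = 0` for all vectors `X` tangent to the leaves. -/
def basicForms (k : ℕ) : Submodule ℂ (RawForm E M k) where
  carrier := {α | IsSmooth α ∧ 𝓕.IsHorizontal α ∧ 𝓕.IsHorizontal (extDerivForm α)}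
  add_mem' {α β} hα hβ := by
    refine ⟨hα.1.add hβ.1, fun i x hx v hv => ?_, ?_⟩
    · exact (congrArg₂ (· + ·) (hα.2.1 i x hx v hv) (hβ.2.1 i x hx v hv)).trans (add_zero 0)
    · rw [extDerivForm_add hα.1 hβ.1]
      intro i x hx v hv
      exact (congrArg₂ (· + ·) (hα.2.2 i x hx v hv) (hβ.2.2 i x hx v hv)).trans (add_zero 0)
  zero_mem' := by
    refine ⟨isSmooth_zero, fun i x hx v hv => rfl, ?_⟩
    rw [extDerivForm_zero]
    exact fun i x hx v hv => rfl
  smul_mem' c α hα := by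
    refine ⟨hα.1.smul c, fun i x hx v hv => ?_, ?_⟩
    · exact (congrArg (c • ·) (hα.2.1 i x hx v hv)).trans (smul_zero c)
    · rw [extDerivForm_smul c hα.1]
      intro i x hx v hv
      exact (congrArg (c • ·) (hα.2.2 i x hx v hv)).trans (smul_zero c)

/-- The exterior derivative `d : Ω^k(M/𝓕, ℂ) → Ω^{k+1}(M/𝓕, ℂ)`. -/
def d [IsManifold 𝓘(ℝ, E) ∞ M] (k : ℕ) : 𝓕.basicForms k →ₗ[ℂ] 𝓕.basicForms (k + 1) where
  toFun α := ⟨extDerivForm α.1, α.2.1.extDerivForm, α.2.2.2, by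
    rw [extDerivForm_extDerivForm α.2.1]
    exact fun i x hx v hv => rfl⟩
  map_add' α β := Subtype.ext (extDerivForm_add α.2.1 β.2.1)
  map_smul' c α := Subtype.ext (extDerivForm_smul c α.2.1)

/-- The basic forms of type `(p, q)`: those which satisfy
`α (λ v₁, …, λ v_k) = λ ^ p * conj λ ^ q * α (v₁, …, v_k)` for all complex numbers `λ`, where `λ`
acts on the normal spaces by their complex structure. (For real `λ` this forces `p + q = k`
if `α ≠ 0`.) -/
def typeForms (k p q : ℕ) : Submodule ℂ (𝓕.basicForms k) where
  carrier := {α | ∀ (c : ℂ) (i : ι), ∀ x ∈ 𝓕.U i, ∀ v w : Fin k → TangentSpace 𝓘(ℝ, E) x,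
    (∀ j, 𝓕.transDeriv i x (w j) = c • 𝓕.transDeriv i x (v j)) →
      α.1 x w = c ^ p * (starRingEnd ℂ c) ^ q * α.1 x v}
  add_mem' {α β} hα hβ c i x hx v w hvw := by
    refine (congrArg₂ (· + ·) (hα c i x hx v w hvw) (hβ c i x hx v w hvw)).trans ?_
    exact (mul_add _ _ _).symm
  zero_mem' c i x hx v w hvw := (mul_zero _).symm
  smul_mem' b α hα c i x hx v w hvw := by
    refine (congrArg (b • ·) (hα c i x hx v w hvw)).trans ?_
    exact mul_left_comm _ _ _

lemma exists_transDeriv_eq (i j : ι) {x : M} (hi : x ∈ 𝓕.U i) (hj : x ∈ 𝓕.U j) :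
    ∃ A : F →L[ℂ] F, ∀ v, 𝓕.transDeriv j x v = A (𝓕.transDeriv i x v) := by
  have h1 := ((𝓕.holomorphic_γ i j).mdifferentiableAt
    (𝓕.mem_source_γ i j x ⟨hi, hj⟩)).hasMFDerivAt
  have h2 : HasMFDerivAt 𝓘(ℝ, E) 𝓘(ℝ, F) (𝓕.f i) x (𝓕.transDeriv i x) :=
    (((𝓕.smooth_f i).contMDiffAt ((𝓕.isOpen_U i).mem_nhds hi)).mdifferentiableAt
      (by simp)).hasMFDerivAt
  have h3 := (HasMFDerivAt.real h1).comp x h2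
  have h4 : 𝓕.f j =ᶠ[𝓝 x] 𝓕.γ i j ∘ 𝓕.f i :=
    Filter.eventuallyEq_of_mem (((𝓕.isOpen_U i).inter (𝓕.isOpen_U j)).mem_nhds ⟨hi, hj⟩)
      fun z hz => 𝓕.cocycle i j z hz
  exact ⟨mfderiv 𝓘(ℂ, F) 𝓘(ℂ, F) (𝓕.γ i j) (𝓕.f i x),
    fun v => DFunLike.congr_fun ((h3.congr_of_eventuallyEq h4).mfderiv) v⟩

lemma exists_lift [FiniteDimensional ℂ F] (c : ℂ) (x : M) :
    ∃ L : TangentSpace 𝓘(ℝ, E) x →L[ℝ] TangentSpace 𝓘(ℝ, E) x,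
      ∀ i, x ∈ 𝓕.U i → ∀ v, 𝓕.transDeriv i x (L v) = c • 𝓕.transDeriv i x v := by
  obtain ⟨i, hi⟩ := 𝓕.cover x
  have : FiniteDimensional ℝ F := FiniteDimensional.complexToReal F
  obtain ⟨R, hR⟩ := (𝓕.transDeriv i x).toLinearMap.exists_rightInverse_of_surjective
    (LinearMap.range_eq_top.2 (𝓕.submersion_f i x hi))
  refine ⟨(LinearMap.toContinuousLinearMap R).comp
    ((c • ContinuousLinearMap.id ℝ F).comp (𝓕.transDeriv i x)), fun j hj v => ?_⟩
  obtain ⟨A, hA⟩ := 𝓕.exists_transDeriv_eq i j hi hj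
  rw [hA, hA]
  have h : 𝓕.transDeriv i x (R (c • 𝓕.transDeriv i x v)) = c • 𝓕.transDeriv i x v :=
    LinearMap.congr_fun hR _
  refine (congrArg A h).trans ?_
  exact A.map_smul c _

/-- A linear endomorphism of `T_x M` which induces on the normal space of the leaf the
multiplication by the complex number `c`. -/
def lift [FiniteDimensional ℂ F] (c : ℂ) (x : M) :
    TangentSpace 𝓘(ℝ, E) x →L[ℝ] TangentSpace 𝓘(ℝ, E) x :=
  (𝓕.exists_lift c x).choose

end TransverselyHolomorphicFoliation

lemma exists_complex_chartDeriv [IsManifold 𝓘(ℂ, F) ω T] {t₀ t : T}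
    (ht : t ∈ (extChartAt 𝓘(ℝ, F) t₀).source) :
    ∃ A : F →L[ℂ] F, HasMFDerivAt 𝓘(ℝ, F) 𝓘(ℝ, F) (extChartAt 𝓘(ℝ, F) t₀) t
      (A.restrictScalars ℝ) ∧ Function.Bijective A := by
  have ht' : t ∈ (chartAt F t₀).source := by simpa using ht
  have : IsManifold 𝓘(ℂ, F) 1 T := IsManifold.of_le (n := ω) le_top
  have h1 : MDifferentiableAt 𝓘(ℂ, F) 𝓘(ℂ, F) (extChartAt 𝓘(ℂ, F) t₀) t :=
    mdifferentiableAt_extChartAt ht'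
  refine ⟨mfderiv 𝓘(ℂ, F) 𝓘(ℂ, F) (extChartAt 𝓘(ℂ, F) t₀) t,
    HasMFDerivAt.real (T' := F) h1.hasMFDerivAt, ?_⟩
  obtain ⟨e, he⟩ := isInvertible_mfderiv_extChartAt (I := 𝓘(ℂ, F)) (x := t₀) (y := t)
    (by simpa using ht')
  rw [← he]
  exact e.bijective

namespace TransverselyHolomorphicFoliation
variable (𝓕 : TransverselyHolomorphicFoliation E M F T ι)

lemma transDeriv_lift [FiniteDimensional ℂ F] (c : ℂ) {i : ι} {x : M} (hx : x ∈ 𝓕.U i)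
    (v : TangentSpace 𝓘(ℝ, E) x) :
    𝓕.transDeriv i x (𝓕.lift c x v) = c • 𝓕.transDeriv i x v :=
  (𝓕.exists_lift c x).choose_spec i hx v

/-- The map `f i` in the charts at `x₀` and `t₀`. -/
def localMap (i : ι) (x₀ : M) (t₀ : T) : E → F :=
  extChartAt 𝓘(ℝ, F) t₀ ∘ 𝓕.f i ∘ (extChartAt 𝓘(ℝ, E) x₀).symm

/-- The domain of `localMap`. -/
def localDomain (i : ι) (x₀ : M) (t₀ : T) : Set E :=
  (extChartAt 𝓘(ℝ, E) x₀).target ∩ (extChartAt 𝓘(ℝ, E) x₀).symm ⁻¹'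
    (𝓕.U i ∩ 𝓕.f i ⁻¹' (extChartAt 𝓘(ℝ, F) t₀).source)

lemma isOpen_localDomain (i : ι) (x₀ : M) (t₀ : T) : IsOpen (𝓕.localDomain i x₀ t₀) := by
  refine (continuousOn_extChartAt_symm x₀).isOpen_inter_preimage (isOpen_extChartAt_target x₀) ?_
  exact (𝓕.smooth_f i).continuousOn.isOpen_inter_preimage (𝓕.isOpen_U i)
    (isOpen_extChartAt_source t₀)

variable [IsManifold 𝓘(ℝ, E) ∞ M] [IsManifold 𝓘(ℂ, F) ω T]

lemma contDiffOn_localMap (i : ι) (x₀ : M) (t₀ : T) :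
    ContDiffOn ℝ ∞ (𝓕.localMap i x₀ t₀) (𝓕.localDomain i x₀ t₀) := by
  have : IsManifold 𝓘(ℝ, F) ∞ T := isManifold_real
  rw [← contMDiffOn_iff_contDiffOn]
  refine (contMDiffOn_extChartAt (n := ∞) (x := t₀)).comp (t := (chartAt F t₀).source)
    ((𝓕.smooth_f i).comp ((contMDiffOn_extChartAt_symm (n := ∞) x₀).mono fun y hy => hy.1)
      fun y hy => hy.2.1) fun y hy => ?_
  have := hy.2.2
  simpa using this

/-- The inverse chart has an invertible derivative. -/
lemma exists_lift_chart {x₀ : M} {y : E} (hy : y ∈ (extChartAt 𝓘(ℝ, E) x₀).target)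
    (w : TangentSpace 𝓘(ℝ, E) ((extChartAt 𝓘(ℝ, E) x₀).symm y)) :
    ∃ v : E, mfderiv 𝓘(ℝ, E) 𝓘(ℝ, E) (extChartAt 𝓘(ℝ, E) x₀).symm y v = w := by
  have : IsManifold 𝓘(ℝ, E) 1 M := IsManifold.of_le (n := ∞) (by simp)
  have h := mfderivWithin_extChartAt_symm_comp_mfderiv_extChartAt (I := 𝓘(ℝ, E)) hy
  simp only [modelWithCornersSelf_coe, Set.range_id, mfderivWithin_univ] at h
  exact ⟨mfderiv 𝓘(ℝ, E) 𝓘(ℝ, E) (extChartAt 𝓘(ℝ, E) x₀) ((extChartAt 𝓘(ℝ, E) x₀).symm y) w,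
    DFunLike.congr_fun h w⟩

lemma exists_fderiv_localMap {i : ι} {x₀ : M} {t₀ : T} {y : E}
    (hy : y ∈ 𝓕.localDomain i x₀ t₀) :
    ∃ A : F →L[ℂ] F, Function.Bijective A ∧ ∀ v : E, fderiv ℝ (𝓕.localMap i x₀ t₀) y v =
      A (𝓕.transDeriv i ((extChartAt 𝓘(ℝ, E) x₀).symm y)
        (mfderiv 𝓘(ℝ, E) 𝓘(ℝ, E) (extChartAt 𝓘(ℝ, E) x₀).symm y v)) := by
  obtain ⟨A, hA, hb⟩ := exists_complex_chartDeriv hy.2.2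
  refine ⟨A, hb, fun v => ?_⟩
  have h2 : HasMFDerivAt 𝓘(ℝ, E) 𝓘(ℝ, F) (𝓕.f i) ((extChartAt 𝓘(ℝ, E) x₀).symm y)
      (𝓕.transDeriv i ((extChartAt 𝓘(ℝ, E) x₀).symm y)) :=
    (((𝓕.smooth_f i).contMDiffAt ((𝓕.isOpen_U i).mem_nhds hy.2.1)).mdifferentiableAt
      (by simp)).hasMFDerivAt
  have h3 := HasMFDerivAt.comp y (f := 𝓕.f i ∘ (extChartAt 𝓘(ℝ, E) x₀).symm) hA
    (h2.comp y (mdiff_symm hy.1).hasMFDerivAt)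
  rw [← mfderiv_eq_fderiv]
  exact DFunLike.congr_fun h3.mfderiv v

variable [FiniteDimensional ℂ F]

/-- A basic form is locally the pullback of a form on the transverse manifold. -/
lemma exists_local_form [FiniteDimensional ℝ E] (α : 𝓕.basicForms k) {i : ι} {x₀ : M} {t₀ : T} {y₀ : E}
    (hy₀ : y₀ ∈ 𝓕.localDomain i x₀ t₀) :
    ∃ (b : F → F [⋀^Fin k]→L[ℝ] ℂ) (V : Set F) (W' : Set E), IsOpen V ∧ IsOpen W' ∧ y₀ ∈ W' ∧
      W' ⊆ 𝓕.localDomain i x₀ t₀ ∧ Set.MapsTo (𝓕.localMap i x₀ t₀) W' V ∧ ContDiffOn ℝ ∞ b V ∧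
      ∀ y ∈ W', chartRep x₀ α.1 y = (b (𝓕.localMap i x₀ t₀ y)).compContinuousLinearMap
        (fderiv ℝ (𝓕.localMap i x₀ t₀) y) := by
  have : FiniteDimensional ℝ F := FiniteDimensional.complexToReal F
  refine exists_local_descent (𝓕.isOpen_localDomain i x₀ t₀) hy₀ (𝓕.contDiffOn_localMap i x₀ t₀)
    ?_ ((α.2.1 x₀).mono fun y hy => hy.1) ?_ ?_
  · intro y hy u
    obtain ⟨A, hA, h⟩ := 𝓕.exists_fderiv_localMap hy
    obtain ⟨u', rfl⟩ := hA.2 u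
    obtain ⟨w, rfl⟩ := 𝓕.submersion_f i _ hy.2.1 u'
    obtain ⟨v, rfl⟩ := exists_lift_chart hy.1 w
    exact ⟨v, h v⟩
  · rintro y hy v ⟨j, hj⟩
    obtain ⟨A, hA, h⟩ := 𝓕.exists_fderiv_localMap hy
    rw [h] at hj
    exact α.2.2.1 i _ hy.2.1 _ ⟨j, (map_eq_zero_iff A hA.1).1 hj⟩
  · rintro y hy v ⟨j, hj⟩
    obtain ⟨A, hA, h⟩ := 𝓕.exists_fderiv_localMap hy
    rw [h] at hj
    rw [← chartRep_extDerivForm α.2.1 hy.1]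
    exact α.2.2.2 i _ hy.2.1 _ ⟨j, (map_eq_zero_iff A hA.1).1 hj⟩

/-- The pointwise action of a complex number on basic forms. -/
def scaleRaw (c : ℂ) (α : RawForm E M k) : RawForm E M k := fun x =>
  (α x).compContinuousLinearMap (𝓕.lift c x)

lemma scaleRaw_local_form (c : ℂ) (α : 𝓕.basicForms k) {i : ι} {x₀ : M} {t₀ : T} {y : E}
    (hy : y ∈ 𝓕.localDomain i x₀ t₀) {b : F [⋀^Fin k]→L[ℝ] ℂ}
    (hb : chartRep x₀ α.1 y = b.compContinuousLinearMap (fderiv ℝ (𝓕.localMap i x₀ t₀) y)) :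
    chartRep x₀ (𝓕.scaleRaw c α.1) y =
      (b.compContinuousLinearMap (c • ContinuousLinearMap.id ℝ F)).compContinuousLinearMap
        (fderiv ℝ (𝓕.localMap i x₀ t₀) y) := by
  ext v
  obtain ⟨A, hA, h⟩ := 𝓕.exists_fderiv_localMap hy
  choose w hw using fun j => exists_lift_chart hy.1
    (𝓕.lift c _ (mfderiv 𝓘(ℝ, E) 𝓘(ℝ, E) (extChartAt 𝓘(ℝ, E) x₀).symm y (v j)))
  have h1 : chartRep x₀ (𝓕.scaleRaw c α.1) y v = chartRep x₀ α.1 y w :=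
    (congrArg (α.1 ((extChartAt 𝓘(ℝ, E) x₀).symm y)) (funext hw)).symm
  rw [h1, hb]
  refine congrArg b (funext fun j => ?_)
  have h2 : fderiv ℝ (𝓕.localMap i x₀ t₀) y (w j) =
      c • fderiv ℝ (𝓕.localMap i x₀ t₀) y (v j) := by
    rw [h, h, hw, 𝓕.transDeriv_lift c hy.2.1, A.map_smul]
  exact h2

lemma scaleRaw_mem [FiniteDimensional ℝ E] (c : ℂ) (α : 𝓕.basicForms k) : 𝓕.scaleRaw c α.1 ∈ 𝓕.basicForms k := by
  have : FiniteDimensional ℝ F := FiniteDimensional.complexToReal F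
  -- the form `c^* b` on the transverse manifold
  have hloc : ∀ (i : ι) (x₀ : M) (y₀ : E), y₀ ∈ (extChartAt 𝓘(ℝ, E) x₀).target →
      (extChartAt 𝓘(ℝ, E) x₀).symm y₀ ∈ 𝓕.U i →
      ContDiffAt ℝ ∞ (chartRep x₀ (𝓕.scaleRaw c α.1)) y₀ ∧
      ∃ (B : F [⋀^Fin (k + 1)]→L[ℝ] ℂ) (A : F →L[ℂ] F), ∀ v : Fin (k + 1) → E,
        extDeriv (chartRep x₀ (𝓕.scaleRaw c α.1)) y₀ v = B fun j =>
          A (𝓕.transDeriv i ((extChartAt 𝓘(ℝ, E) x₀).symm y₀)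
            (mfderiv 𝓘(ℝ, E) 𝓘(ℝ, E) (extChartAt 𝓘(ℝ, E) x₀).symm y₀ (v j))) := by
    intro i x₀ y₀ hy₀ hi
    set t₀ := 𝓕.f i ((extChartAt 𝓘(ℝ, E) x₀).symm y₀) with ht₀
    have hdom : y₀ ∈ 𝓕.localDomain i x₀ t₀ := ⟨hy₀, hi, mem_extChartAt_source t₀⟩
    obtain ⟨b, V, W', hV, hW', hyW', hsub, hmaps, hb, hrep⟩ := 𝓕.exists_local_form α hdom
    let b' : F → F [⋀^Fin k]→L[ℝ] ℂ := fun t =>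
      (b t).compContinuousLinearMap (c • ContinuousLinearMap.id ℝ F)
    have hb' : ContDiffOn ℝ ∞ b' V := contDiffOn_pullback hb contDiffOn_const
    have hg : ContDiffOn ℝ ∞ (𝓕.localMap i x₀ t₀) W' :=
      (𝓕.contDiffOn_localMap i x₀ t₀).mono hsub
    have heq : Set.EqOn (chartRep x₀ (𝓕.scaleRaw c α.1)) (fun y =>
        (b' (𝓕.localMap i x₀ t₀ y)).compContinuousLinearMap
          (fderiv ℝ (𝓕.localMap i x₀ t₀) y)) W' := fun y hy =>
      𝓕.scaleRaw_local_form c α (hsub hy) (hrep y hy)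
    refine ⟨?_, extDeriv b' (𝓕.localMap i x₀ t₀ y₀), ?_⟩
    · refine ContDiffOn.contDiffAt (s := W') ?_ (hW'.mem_nhds hyW')
      exact (contDiffOn_pullback (hb'.comp hg hmaps)
        (hg.fderiv_of_isOpen hW' (by simp))).congr heq
    · obtain ⟨A, -, hA⟩ := 𝓕.exists_fderiv_localMap hdom
      refine ⟨A, fun v => ?_⟩
      rw [(Filter.eventuallyEq_of_mem (hW'.mem_nhds hyW') heq).extDeriv_eq,
        extDeriv_pullback (r := ∞)
          ((hb'.contDiffAt (hV.mem_nhds (hmaps hyW'))).differentiableAt (by simp))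
          (hg.contDiffAt (hW'.mem_nhds hyW')) minSmoothness_two_le]
      exact congrArg (extDeriv b' (𝓕.localMap i x₀ t₀ y₀)) (funext fun j => hA (v j))
  have hsm : IsSmooth (𝓕.scaleRaw c α.1) := by
    intro x₀ y hy
    obtain ⟨i, hi⟩ := 𝓕.cover ((extChartAt 𝓘(ℝ, E) x₀).symm y)
    exact (hloc i x₀ y hy hi).1.contDiffWithinAt
  refine ⟨hsm, ?_, ?_⟩
  · rintro i x hx v ⟨j, hj⟩
    refine α.2.2.1 i x hx _ ⟨j, ?_⟩
    refine (𝓕.transDeriv_lift c hx (v j)).trans ?_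
    rw [hj, smul_zero]
  · rintro i x hx v ⟨j, hj⟩
    have hxs : (extChartAt 𝓘(ℝ, E) x).symm (extChartAt 𝓘(ℝ, E) x x) = x :=
      extChartAt_to_inv x
    obtain ⟨-, B, A, h⟩ := hloc i x _ (mem_extChartAt_target x) (by rwa [hxs])
    refine (h _).trans (B.map_coord_zero j ?_)
    refine (congrArg A ?_).trans A.map_zero
    rw [← hj]
    have hf : HasMFDerivAt 𝓘(ℝ, E) 𝓘(ℝ, F) (𝓕.f i)
        ((extChartAt 𝓘(ℝ, E) x).symm (extChartAt 𝓘(ℝ, E) x x)) (𝓕.transDeriv i _) :=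
      (((𝓕.smooth_f i).contMDiffAt ((𝓕.isOpen_U i).mem_nhds (by rwa [hxs]))).mdifferentiableAt
        (by simp)).hasMFDerivAt
    have h2 := HasMFDerivAt.comp x (hf.comp _ (mdiff_symm (mem_extChartAt_target x)).hasMFDerivAt)
      (mdiff_chart (mem_extChartAt_source x)).hasMFDerivAt
    have h3 : 𝓕.f i =ᶠ[𝓝 x]
        (𝓕.f i ∘ (extChartAt 𝓘(ℝ, E) x).symm) ∘ extChartAt 𝓘(ℝ, E) x :=
      Filter.eventuallyEq_of_mem (extChartAt_source_mem_nhds x) fun z hz =>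
        congrArg (𝓕.f i) ((extChartAt 𝓘(ℝ, E) x).left_inv hz).symm
    exact (DFunLike.congr_fun (h2.congr_of_eventuallyEq h3).mfderiv (v j)).symm

/-- The action `α ↦ c^* α` of a complex number `c` on basic forms, where
`(c^* α) (v₁, …, v_k) = α (c v₁, …, c v_k)`. -/
def scale [FiniteDimensional ℝ E] (k : ℕ) (c : ℂ) : 𝓕.basicForms k →ₗ[ℂ] 𝓕.basicForms k where
  toFun α := ⟨𝓕.scaleRaw c α.1, 𝓕.scaleRaw_mem c α⟩
  map_add' _ _ := rfl
  map_smul' _ _ := rfl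

end TransverselyHolomorphicFoliation

namespace TransverselyHolomorphicFoliation
variable (𝓕 : TransverselyHolomorphicFoliation E M F T ι)
  [IsManifold 𝓘(ℝ, E) ∞ M] [IsManifold 𝓘(ℂ, F) ω T] [FiniteDimensional ℝ E]
  [FiniteDimensional ℂ F]

lemma scale_apply (c : ℂ) (α : 𝓕.basicForms k) {i : ι} {x : M} (hx : x ∈ 𝓕.U i)
    {v w : Fin k → TangentSpace 𝓘(ℝ, E) x}
    (h : ∀ j, 𝓕.transDeriv i x (w j) = c • 𝓕.transDeriv i x (v j)) :
    (𝓕.scale k c α).1 x v = α.1 x w := by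
  refine alternating_congr (α.1 x) (𝓕.transDeriv i x).toLinearMap (α.2.2.1 i x hx) _ _ fun j => ?_
  exact (𝓕.transDeriv_lift c hx (v j)).trans (h j).symm

lemma scale_of_mem_typeForms {p q : ℕ} {α : 𝓕.basicForms k} (hα : α ∈ 𝓕.typeForms k p q) (c : ℂ) :
    𝓕.scale k c α = (c ^ p * (starRingEnd ℂ c) ^ q) • α := by
  refine Subtype.ext (funext fun x => ?_)
  obtain ⟨i, hi⟩ := 𝓕.cover x
  ext v
  exact hα c i x hi v _ fun j => 𝓕.transDeriv_lift c hi (v j)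

/-- The projection of the basic `k`-forms onto the forms of type `(p, q)`, for `p + q = k`,
along the forms of the other types. Since `c^* α = c ^ p * conj c ^ q * α` on forms of type
`(p, q)`, it is the average of `conj (c ^ p * conj c ^ q) * c^* α` over the roots of unity `c` of
order `2 * k + 1`. -/
def typeProj (k p q : ℕ) : 𝓕.basicForms k →ₗ[ℂ] 𝓕.basicForms k :=
  if p + q = k then
    ((2 * k + 1 : ℕ) : ℂ)⁻¹ • ∑ m ∈ Finset.range (2 * k + 1),
      let c : ℂ := Complex.exp (2 * Real.pi * Complex.I / (2 * k + 1 : ℕ)) ^ m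
      (starRingEnd ℂ (c ^ p * (starRingEnd ℂ c) ^ q)) • 𝓕.scale k c
  else 0

lemma typeProj_of_mem {p q p' q' : ℕ} (h : p + q = k) (h' : p' + q' = k) {α : 𝓕.basicForms k}
    (hα : α ∈ 𝓕.typeForms k p' q') :
    𝓕.typeProj k p q α = if p = p' then α else 0 := by
  set N := 2 * k + 1 with hN
  set ζ : ℂ := Complex.exp (2 * Real.pi * Complex.I / (N : ℕ)) with hζ
  have hprim : IsPrimitiveRoot ζ N := Complex.isPrimitiveRoot_exp N (by omega)
  have hnorm : ‖ζ‖ = 1 := hprim.norm'_eq_one (by omega)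
  have hconj : ζ * starRingEnd ℂ ζ = 1 := by
    rw [Complex.mul_conj, Complex.normSq_eq_norm_sq, hnorm]; simp
  have hz0 : ζ ≠ 0 := hprim.ne_zero (by omega)
  have hc : starRingEnd ℂ ζ = ζ⁻¹ := eq_inv_of_mul_eq_one_right hconj
  have hval : 𝓕.typeProj k p q α =
      ((N : ℂ)⁻¹ * ∑ m ∈ Finset.range N, (ζ ^ (2 * (p' : ℤ) - 2 * p)) ^ m) • α := by
    rw [typeProj, if_pos h]
    simp only [LinearMap.smul_apply, LinearMap.sum_apply, 𝓕.scale_of_mem_typeForms hα,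
      smul_smul, ← Finset.sum_smul]
    congr 2
    refine Finset.sum_congr rfl fun m _ => ?_
    rw [← hN, ← hζ]
    simp only [map_mul, map_pow, hc, map_inv₀, inv_inv]
    simp only [← zpow_natCast, inv_zpow', ← zpow_mul, ← zpow_add₀ hz0]
    congr 1
    subst h
    have : (q' : ℤ) = p + q - p' := by omega
    rw [this]; ring
  rw [hval]
  split_ifs with hp
  · subst hp
    have : (N : ℂ) ≠ 0 := Nat.cast_ne_zero.2 (by omega)
    simp [this]
  · have hne : ζ ^ (2 * (p' : ℤ) - 2 * p) ≠ 1 := by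
      intro h1
      have h2 := (hprim.zpow_eq_one_iff_dvd _).1 h1
      have h3 := Int.eq_zero_of_abs_lt_dvd h2 (by rw [abs_lt]; constructor <;> push_cast [hN] <;> omega)
      omega
    have hpow : (ζ ^ (2 * (p' : ℤ) - 2 * p)) ^ N = 1 := by
      rw [← zpow_natCast, ← zpow_mul, mul_comm, zpow_mul, zpow_natCast, hprim.pow_eq_one,
        one_zpow]
    rw [geom_sum_eq hne, hpow]
    simp

/-- The operator `∂ = ∑ π^{p+1,q} d π^{p,q}` on basic `k`-forms. -/
def del (k : ℕ) : 𝓕.basicForms k →ₗ[ℂ] 𝓕.basicForms (k + 1) :=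
  ∑ pq ∈ Finset.HasAntidiagonal.antidiagonal k,
    𝓕.typeProj (k + 1) (pq.1 + 1) pq.2 ∘ₗ 𝓕.d k ∘ₗ 𝓕.typeProj k pq.1 pq.2

/-- The operator `∂̄ = ∑ π^{p,q+1} d π^{p,q}` on basic `k`-forms. -/
def delbar (k : ℕ) : 𝓕.basicForms k →ₗ[ℂ] 𝓕.basicForms (k + 1) :=
  ∑ pq ∈ Finset.HasAntidiagonal.antidiagonal k,
    𝓕.typeProj (k + 1) pq.1 (pq.2 + 1) ∘ₗ 𝓕.d k ∘ₗ 𝓕.typeProj k pq.1 pq.2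

/-- `Im d` in degree `k`. -/
def imD : (k : ℕ) → Submodule ℂ (𝓕.basicForms k)
  | 0 => ⊥
  | k + 1 => LinearMap.range (𝓕.d k)

/-- `Im ∂` in degree `k`. -/
def imDel : (k : ℕ) → Submodule ℂ (𝓕.basicForms k)
  | 0 => ⊥
  | k + 1 => LinearMap.range (𝓕.del k)

/-- `Im ∂̄` in degree `k`. -/
def imDelbar : (k : ℕ) → Submodule ℂ (𝓕.basicForms k)
  | 0 => ⊥
  | k + 1 => LinearMap.range (𝓕.delbar k)

/-- `Im ∂∂̄` in degree `k`. -/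
def imDelDelbar : (k : ℕ) → Submodule ℂ (𝓕.basicForms k)
  | 0 => ⊥
  | 1 => ⊥
  | k + 2 => LinearMap.range (𝓕.del (k + 1) ∘ₗ 𝓕.delbar k)

/-- The basic cohomology `H^k(M/𝓕, ℂ) = Ker d / Im d`. -/
abbrev BasicCohomology (k : ℕ) : Type _ :=
  ↥(LinearMap.ker (𝓕.d k)) ⧸ (𝓕.imD k).submoduleOf (LinearMap.ker (𝓕.d k))

/-- The closed forms of type `(p, q)` for `∂̄`. -/
def kerDelbar (p q : ℕ) : Submodule ℂ (𝓕.basicForms (p + q)) :=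
  𝓕.typeForms (p + q) p q ⊓ LinearMap.ker (𝓕.delbar (p + q))

/-- The basic Dolbeault cohomology: the part of type `(p, q)` of `Ker ∂̄ / Im ∂̄`. -/
abbrev DolbeaultCohomology (p q : ℕ) : Type _ :=
  ↥(𝓕.kerDelbar p q) ⧸ (𝓕.imDelbar (p + q)).submoduleOf (𝓕.kerDelbar p q)

/-- The forms of type `(p, q)` in `Ker ∂ ∩ Ker ∂̄`. -/
def kerBottChern (p q : ℕ) : Submodule ℂ (𝓕.basicForms (p + q)) :=
  𝓕.typeForms (p + q) p q ⊓
    (LinearMap.ker (𝓕.del (p + q)) ⊓ LinearMap.ker (𝓕.delbar (p + q)))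

/-- The basic Bott-Chern cohomology: the part of type `(p, q)` of
`(Ker ∂ ∩ Ker ∂̄) / Im ∂∂̄`. -/
abbrev BottChernCohomology (p q : ℕ) : Type _ :=
  ↥(𝓕.kerBottChern p q) ⧸ (𝓕.imDelDelbar (p + q)).submoduleOf (𝓕.kerBottChern p q)

/-- The forms of type `(p, q)` in `Ker ∂∂̄`. -/
def kerAeppli (p q : ℕ) : Submodule ℂ (𝓕.basicForms (p + q)) :=
  𝓕.typeForms (p + q) p q ⊓ LinearMap.ker (𝓕.del (p + q + 1) ∘ₗ 𝓕.delbar (p + q))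

/-- The basic Aeppli cohomology: the part of type `(p, q)` of `Ker ∂∂̄ / (Im ∂ + Im ∂̄)`. -/
abbrev AeppliCohomology (p q : ℕ) : Type _ :=
  ↥(𝓕.kerAeppli p q) ⧸
    (𝓕.imDel (p + q) ⊔ 𝓕.imDelbar (p + q)).submoduleOf (𝓕.kerAeppli p q)

/-- The `∂∂̄`-lemma for the basic Dolbeault double complex:
`Ker ∂ ∩ Ker ∂̄ ∩ Im d = Im ∂∂̄`. -/
def SatisfiesDelDelbarLemma : Prop :=
  ∀ k, LinearMap.ker (𝓕.del k) ⊓ LinearMap.ker (𝓕.delbar k) ⊓ 𝓕.imD k = 𝓕.imDelDelbar k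

end TransverselyHolomorphicFoliation
end Foliations

end BasicForms

end

/-!
A closed basic form `z` satisfies `∂̄z = -∂z`. Let `z_v` be the form obtained from `z` by
multiplying its component of type `(p, k - p)` by `v p`. If `v p = u (p + 1) - u p`, then comparing
types gives `∂z_v = -d z_u`. Hence every form `z_v` has an exact `∂z_v`, and in particular `∂z` is
exact: it is `dw` for some `w` such that `∂w` is exact too.

Let the defect in degree `k` be the dimension of `(Ker ∂ ∩ Ker ∂̄ ∩ Im d) / Im ∂∂̄`, which vanishes
in all degrees exactly when the `∂∂̄`-lemma holds. The Bott-Chern cohomology of degree `k` is an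
extension of the image of `Ker ∂ ∩ Ker ∂̄` in `H^k` by a space whose dimension is the defect in
degree `k`. The Aeppli cohomology is an extension, by the image of `Ker d`, of a space which `d`
identifies with the one defining the defect in degree `k + 1`. What these two images miss of two
copies of `H^k` is controlled by `∂`. It maps `H^k` modulo the classes of `Ker ∂ ∩ Ker ∂̄`
injectively into the defect space of degree `k + 1`, and it maps `Ker ∂∂̄ / (Ker d + Im ∂ + Im ∂̄)`
in degree `k - 1` onto the kernel of the map from `H^k` to the Aeppli cohomology. This proves the
inequality.

If equality holds and the `H^k` are finite-dimensional, both comparison maps are bijective. An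
element of a defect space is then represented by `∂z` with `z` closed. Write `∂z = dw` with `∂w`
exact. By injectivity of the second comparison map, `w` lies in `Ker d + Im ∂ + Im ∂̄`, so that
`dw` lies in `Im ∂∂̄`.

The Hodge filtration bounds the dimension of `H^k` by those of the Dolbeault cohomologies of degree
`k`, which gives its finiteness.
-/

noncomputable section

namespace BasicForms

open scoped ComplexConjugate

section RelativeRank
universe u
variable {𝕜 : Type*} [Field 𝕜] {V W : Type u} [AddCommGroup V] [Module 𝕜 V]
  [AddCommGroup W] [Module 𝕜 W]

/-- The dimension of the image of `K` in `V ⧸ N`; for `N ≤ K` it is the dimension of `K / N`. Not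
requiring `N ≤ K` spares the proof of this inclusion for each of the cohomologies below. -/
def relRank (K N : Submodule 𝕜 V) : Cardinal :=
  Module.rank 𝕜 (K ⧸ N.submoduleOf K)

lemma relRank_le_of_injective {K N : Submodule 𝕜 V} {K' N' : Submodule 𝕜 W} (f : V →ₗ[𝕜] W)
    (hK : ∀ x ∈ K, f x ∈ K') (hN : ∀ x ∈ K, f x ∈ N' → x ∈ N) :
    relRank K N ≤ relRank K' N' := by
  let g : K →ₗ[𝕜] K' ⧸ N'.submoduleOf K' := (N'.submoduleOf K').mkQ ∘ₗ f.restrict hK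
  have hg : LinearMap.ker g ≤ N.submoduleOf K := fun x hx =>
    hN x x.2 ((Submodule.Quotient.mk_eq_zero (N'.submoduleOf K')).1 hx)
  calc relRank K N ≤ Module.rank 𝕜 (K ⧸ LinearMap.ker g) :=
        LinearMap.rank_le_of_surjective (Submodule.factor hg) (Submodule.factor_surjective hg)
    _ = Module.rank 𝕜 (LinearMap.range g) := g.quotKerEquivRange.rank_eq
    _ ≤ relRank K' N' := Submodule.rank_le _

lemma relRank_le_of_surjective {K N : Submodule 𝕜 V} {K' N' : Submodule 𝕜 W} (f : V →ₗ[𝕜] W)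
    (hK : ∀ x ∈ K, f x ∈ K') (hN : ∀ x ∈ K, x ∈ N → f x ∈ N')
    (hs : ∀ y ∈ K', ∃ x ∈ K, y - f x ∈ N') :
    relRank K' N' ≤ relRank K N := by
  refine LinearMap.rank_le_of_surjective (Submodule.mapQ (N.submoduleOf K) (N'.submoduleOf K')
    (f.restrict hK) fun x hx => hN x x.2 hx) fun y => ?_
  obtain ⟨⟨y, hy⟩, rfl⟩ := Submodule.mkQ_surjective _ y
  obtain ⟨x, hx, hxy⟩ := hs y hy
  exact ⟨Submodule.Quotient.mk ⟨x, hx⟩, ((Submodule.Quotient.eq (N'.submoduleOf K')).2 hxy).symm⟩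

lemma relRank_eq_zero_iff {K N : Submodule 𝕜 V} : relRank K N = 0 ↔ K ≤ N := by
  rw [relRank, rank_zero_iff, Submodule.Quotient.subsingleton_iff, Submodule.submoduleOf_eq_top]

lemma relRank_mono_left {K K' : Submodule 𝕜 V} (N : Submodule 𝕜 V) (h : K ≤ K') :
    relRank K N ≤ relRank K' N :=
  relRank_le_of_injective LinearMap.id (fun _ hx => h hx) fun _ _ hx => hx

lemma relRank_inf (K N : Submodule 𝕜 V) : relRank K (K ⊓ N) = relRank K N := by
  rw [relRank, Submodule.submoduleOf, Submodule.comap_inf, Submodule.comap_subtype_self,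
    top_inf_eq, relRank, Submodule.submoduleOf]

lemma relRank_sup (K N : Submodule 𝕜 V) : relRank (K ⊔ N) N = relRank K N := by
  refine le_antisymm ?_ (relRank_mono_left N le_sup_left)
  refine relRank_le_of_surjective LinearMap.id (fun x hx => Submodule.mem_sup_left hx)
    (fun x _ h => h) fun y hy => ?_
  obtain ⟨a, ha, b, hb, rfl⟩ := Submodule.mem_sup.1 hy
  exact ⟨a, ha, by simpa using hb⟩

lemma relRank_eq_add {N L K : Submodule 𝕜 V} (hNL : N ≤ L) (hLK : L ≤ K) :
    relRank K N = relRank K L + relRank L N := by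
  let g : L →ₗ[𝕜] K ⧸ N.submoduleOf K := (N.submoduleOf K).mkQ ∘ₗ Submodule.inclusion hLK
  have hker : LinearMap.ker g = N.submoduleOf L := by
    rw [LinearMap.ker_comp, Submodule.ker_mkQ]
    rfl
  have hrange : LinearMap.range g = (L.submoduleOf K).map (N.submoduleOf K).mkQ := by
    rw [LinearMap.range_comp, Submodule.range_inclusion]
    rfl
  have e := Submodule.quotientQuotientEquivQuotient (N.submoduleOf K) (L.submoduleOf K)
    (Submodule.comap_mono hNL)
  rw [relRank, relRank, relRank, ← hker, g.quotKerEquivRange.rank_eq, ← e.rank_eq, hrange,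
    Submodule.rank_quotient_add_rank]

lemma relRank_eq_sum_of_antitone {Z : ℕ → Submodule 𝕜 V} (hZ : Antitone Z) (n : ℕ) :
    relRank (Z 0) (Z n) = ∑ m ∈ Finset.range n, relRank (Z m) (Z (m + 1)) := by
  induction n with
  | zero => exact relRank_eq_zero_iff.2 le_rfl
  | succ n ih =>
    rw [relRank_eq_add (hZ n.le_succ) (hZ n.zero_le), ih, Finset.sum_range_succ, add_comm]

lemma le_of_relRank_le_relRank_left {N L K : Submodule 𝕜 V} (hNL : N ≤ L) (hLK : L ≤ K)
    (hfin : relRank K N < Cardinal.aleph0) (h : relRank K N ≤ relRank L N) : K ≤ L := by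
  have hL : relRank L N < Cardinal.aleph0 := (relRank_mono_left N hLK).trans_lt hfin
  have hadd : relRank K L + relRank L N ≤ 0 + relRank L N := by
    rwa [zero_add, ← relRank_eq_add hNL hLK]
  exact relRank_eq_zero_iff.1
    (nonpos_iff_eq_zero.1 ((Cardinal.add_le_add_iff_of_lt_aleph0 hL).1 hadd))

lemma le_of_relRank_le_relRank_right {N L K : Submodule 𝕜 V} (hNL : N ≤ L) (hLK : L ≤ K)
    (hfin : relRank K N < Cardinal.aleph0) (h : relRank K N ≤ relRank K L) : L ≤ N := by
  have hadd := relRank_eq_add hNL hLK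
  have hL : relRank K L < Cardinal.aleph0 := (le_self_add.trans hadd.ge).trans_lt hfin
  have hle : relRank L N + relRank K L ≤ 0 + relRank K L := by rwa [zero_add, add_comm, ← hadd]
  exact relRank_eq_zero_iff.1
    (nonpos_iff_eq_zero.1 ((Cardinal.add_le_add_iff_of_lt_aleph0 hL).1 hle))

lemma surjective_of_injective_of_relRank_le {K N : Submodule 𝕜 V} {K' N' : Submodule 𝕜 W}
    (f : V →ₗ[𝕜] W) (hK : ∀ x ∈ K, f x ∈ K') (hN : ∀ x ∈ K, f x ∈ N' → x ∈ N) (hN' : N' ≤ K')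
    (hfin : relRank K' N' < Cardinal.aleph0) (hle : relRank K' N' ≤ relRank K N) :
    ∀ y ∈ K', ∃ x ∈ K, y - f x ∈ N' := by
  have himage : relRank K N ≤ relRank (K.map f ⊔ N') N' :=
    relRank_le_of_injective f (fun x hx => Submodule.mem_sup_left ⟨x, hx, rfl⟩) hN
  have hle_image : K' ≤ K.map f ⊔ N' :=
    le_of_relRank_le_relRank_left le_sup_right
      (sup_le (Submodule.map_le_iff_le_comap.2 hK) hN') hfin (hle.trans himage)
  intro y hy
  obtain ⟨_, ⟨x, hx, rfl⟩, b, hb, rfl⟩ := Submodule.mem_sup.1 (hle_image hy)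
  exact ⟨x, hx, by simpa using hb⟩

lemma injective_of_surjective_of_relRank_le {K N : Submodule 𝕜 V} {K' N' : Submodule 𝕜 W}
    (f : V →ₗ[𝕜] W) (hK : ∀ x ∈ K, f x ∈ K') (hN : ∀ x ∈ N, f x ∈ N')
    (hs : ∀ y ∈ K', ∃ x ∈ K, y - f x ∈ N') (hNK : N ≤ K)
    (hfin : relRank K N < Cardinal.aleph0) (hle : relRank K N ≤ relRank K' N') :
    ∀ x ∈ K, f x ∈ N' → x ∈ N := by
  have hkernel : relRank K' N' ≤ relRank K (K ⊓ N'.comap f) :=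
    relRank_le_of_surjective f hK (fun x _ h => h.2) hs
  have hkernel_le : K ⊓ N'.comap f ≤ N :=
    le_of_relRank_le_relRank_right (fun x hx => ⟨hNK hx, hN x hx⟩) inf_le_left hfin
      (hle.trans hkernel)
  exact fun x hx hfx => hkernel_le ⟨hx, hfx⟩

end RelativeRank

section Decompositions
universe u
variable {𝕜 : Type*} [Field 𝕜] {V W : Type u} [AddCommGroup V] [Module 𝕜 V]
  [AddCommGroup W] [Module 𝕜 W]

/-- The `π p` with `p < n` are the projections of a direct sum decomposition of `V`, and the others
vanish. -/
structure IsDecomposition (π : ℕ → V →ₗ[𝕜] V) (n : ℕ) : Prop where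
  proj_proj : ∀ p q x, π p (π q x) = if p = q then π p x else 0
  sum_proj : ∀ x, ∑ p ∈ Finset.range n, π p x = x

/-- The decreasing filtration attached to a decomposition: the sum of the components of index at
least `m`, encoded as the common kernel of the other projections. For forms decomposed by type it
is the Hodge filtration. -/
def filtration (π : ℕ → V →ₗ[𝕜] V) (m : ℕ) : Submodule 𝕜 V :=
  ⨅ p : Fin m, LinearMap.ker (π p)

lemma mem_filtration {π : ℕ → V →ₗ[𝕜] V} {m : ℕ} {x : V} :
    x ∈ filtration π m ↔ ∀ p < m, π p x = 0 := by
  simp only [filtration, Submodule.mem_iInf, LinearMap.mem_ker, Fin.forall_iff]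

lemma antitone_filtration (π : ℕ → V →ₗ[𝕜] V) : Antitone (filtration π) := fun _ _ h _ hx =>
  mem_filtration.2 fun p hp => mem_filtration.1 hx p (hp.trans_le h)

lemma filtration_zero (π : ℕ → V →ₗ[𝕜] V) : filtration π 0 = ⊤ :=
  top_unique fun _ _ => mem_filtration.2 fun _ hp => absurd hp (Nat.not_lt_zero _)

/-- The endomorphism acting as the scalar `w p` on the `p`-th component. -/
def weight (π : ℕ → V →ₗ[𝕜] V) (n : ℕ) (w : ℕ → 𝕜) : V →ₗ[𝕜] V :=
  ∑ p ∈ Finset.range n, w p • π p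

/-- `f` maps the `p`-th component of the source to the `(p + s)`-th one of the target. -/
def HasShift (π : ℕ → V →ₗ[𝕜] V) (π' : ℕ → W →ₗ[𝕜] W) (s : ℕ) (f : V →ₗ[𝕜] W) : Prop :=
  ∀ p x, f (π p x) = π' (p + s) (f x)

/-- The part of a linear map which raises the index of the components by `s`. -/
def shiftPart (π : ℕ → V →ₗ[𝕜] V) (n : ℕ) (π' : ℕ → W →ₗ[𝕜] W) (s : ℕ) (f : V →ₗ[𝕜] W) :
    V →ₗ[𝕜] W :=
  ∑ p ∈ Finset.range n, π' (p + s) ∘ₗ f ∘ₗ π p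

lemma shiftPart_add (π : ℕ → V →ₗ[𝕜] V) (n : ℕ) (π' : ℕ → W →ₗ[𝕜] W) (s : ℕ)
    (f g : V →ₗ[𝕜] W) :
    shiftPart π n π' s (f + g) = shiftPart π n π' s f + shiftPart π n π' s g := by
  simp only [shiftPart, LinearMap.add_comp, LinearMap.comp_add, Finset.sum_add_distrib]

lemma shiftPart_zero (π : ℕ → V →ₗ[𝕜] V) (n : ℕ) (π' : ℕ → W →ₗ[𝕜] W) (s : ℕ) :
    shiftPart π n π' s 0 = 0 := by
  simp only [shiftPart, LinearMap.zero_comp, LinearMap.comp_zero, Finset.sum_const_zero]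

namespace IsDecomposition
variable {π : ℕ → V →ₗ[𝕜] V} {n : ℕ} {π' : ℕ → W →ₗ[𝕜] W} {n' : ℕ}

lemma proj_proj_self (h : IsDecomposition π n) (p : ℕ) (x : V) : π p (π p x) = π p x := by
  rw [h.proj_proj, if_pos rfl]

lemma proj_proj_of_ne (h : IsDecomposition π n) {p q : ℕ} (hpq : p ≠ q) (x : V) :
    π p (π q x) = 0 := by
  rw [h.proj_proj, if_neg hpq]

lemma mem_range_proj_iff (h : IsDecomposition π n) {p : ℕ} {x : V} :
    x ∈ LinearMap.range (π p) ↔ π p x = x := by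
  refine ⟨?_, fun hx => ⟨x, hx⟩⟩
  rintro ⟨y, rfl⟩
  exact h.proj_proj_self p y

lemma proj_of_le (h : IsDecomposition π n) {p : ℕ} (hp : n ≤ p) (x : V) : π p x = 0 := by
  rw [← h.sum_proj (π p x)]
  exact Finset.sum_eq_zero fun q hq =>
    h.proj_proj_of_ne ((Finset.mem_range.1 hq).trans_le hp).ne x

lemma ext (h : IsDecomposition π n) {x y : V} (hxy : ∀ p, π p x = π p y) : x = y := by
  rw [← h.sum_proj x, ← h.sum_proj y]
  exact Finset.sum_congr rfl fun p _ => hxy p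

lemma map_eq_sum (h : IsDecomposition π n) (f : V →ₗ[𝕜] W) (x : V) :
    f x = ∑ p ∈ Finset.range n, f (π p x) := by
  rw [← map_sum, h.sum_proj]

lemma proj_weight (h : IsDecomposition π n) (w : ℕ → 𝕜) (p : ℕ) (x : V) :
    π p (weight π n w x) = w p • π p x := by
  rcases lt_or_ge p n with hp | hp
  · simp [weight, h.proj_proj, hp]
  · rw [h.proj_of_le hp, h.proj_of_le hp, smul_zero]

lemma weight_proj (h : IsDecomposition π n) (w : ℕ → 𝕜) (p : ℕ) (x : V) :
    weight π n w (π p x) = w p • π p x := by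
  refine h.ext fun q => ?_
  rw [h.proj_weight, map_smul, h.proj_proj]
  split_ifs with hqp
  · rw [hqp]
  · rw [smul_zero, smul_zero]

lemma filtration_eq_bot (h : IsDecomposition π n) : filtration π n = ⊥ := by
  refine (Submodule.eq_bot_iff _).2 fun x hx => ?_
  rw [← h.sum_proj x]
  exact Finset.sum_eq_zero fun p hp => mem_filtration.1 hx p (Finset.mem_range.1 hp)

lemma proj_mem_filtration (h : IsDecomposition π n) (m : ℕ) (x : V) :
    π m x ∈ filtration π m :=
  mem_filtration.2 fun _ hp => h.proj_proj_of_ne hp.ne x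

lemma sub_proj_mem_filtration (h : IsDecomposition π n) {m : ℕ} {x : V}
    (hx : x ∈ filtration π m) : x - π m x ∈ filtration π (m + 1) := by
  refine mem_filtration.2 fun p hp => ?_
  rcases Nat.lt_succ_iff_lt_or_eq.1 hp with hp | rfl
  · rw [map_sub, mem_filtration.1 hx p hp, h.proj_proj_of_ne hp.ne, sub_zero]
  · rw [map_sub, h.proj_proj_self, sub_self]

lemma relRank_eq_sum_filtration (h : IsDecomposition π n) (K N : Submodule 𝕜 V) :
    relRank K N = ∑ m ∈ Finset.range n,
      relRank (K ⊓ filtration π m) (K ⊓ filtration π (m + 1) ⊔ N) := by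
  have hanti : Antitone fun m => K ⊓ filtration π m ⊔ N := fun _ _ hm =>
    sup_le_sup_right (inf_le_inf_left K (antitone_filtration π hm)) N
  have hsum := relRank_eq_sum_of_antitone hanti n
  simp only [filtration_zero, h.filtration_eq_bot, inf_top_eq, inf_bot_eq, bot_sup_eq] at hsum
  rw [← relRank_sup, hsum]
  refine Finset.sum_congr rfl fun m _ => ?_
  have hle : K ⊓ filtration π (m + 1) ≤ K ⊓ filtration π m :=
    inf_le_inf_left K (antitone_filtration π m.le_succ)
  rw [← relRank_sup (K ⊓ filtration π m), ← sup_assoc, sup_eq_left.2 hle]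

lemma relRank_eq_sum (h : IsDecomposition π n) {K N : Submodule 𝕜 V}
    (hK : ∀ p, ∀ x ∈ K, π p x ∈ K) (hN : ∀ p, ∀ x ∈ N, π p x ∈ N) :
    relRank K N = ∑ p ∈ Finset.range n, relRank (LinearMap.range (π p) ⊓ K) N := by
  rw [h.relRank_eq_sum_filtration]
  refine Finset.sum_congr rfl fun p _ => le_antisymm ?_ ?_
  · refine relRank_le_of_injective (π p) (fun x hx => ⟨⟨x, rfl⟩, hK p x hx.1⟩) fun x hx hpx => ?_
    have hsub : x - π p x ∈ K ⊓ filtration π (p + 1) :=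
      ⟨K.sub_mem hx.1 (hK p x hx.1), h.sub_proj_mem_filtration hx.2⟩
    simpa using Submodule.add_mem_sup hsub hpx
  · refine relRank_le_of_injective LinearMap.id (fun x hx => ⟨hx.2, ?_⟩) fun x hx hx' => ?_
    · simpa [h.mem_range_proj_iff.1 hx.1] using h.proj_mem_filtration p x
    · obtain ⟨a, ha, b, hb, hab⟩ := Submodule.mem_sup.1 hx'
      have hpa : π p a = 0 := mem_filtration.1 ha.2 p p.lt_succ_self
      have hpb : π p b = x := by
        rw [← h.mem_range_proj_iff.1 hx.1, ← LinearMap.id_apply (R := 𝕜) x, ← hab, map_add, hpa,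
          zero_add]
      exact hpb ▸ hN p b hb

lemma map_weight_of_hasShift (h : IsDecomposition π n) (h' : IsDecomposition π' n') {s : ℕ}
    {f : V →ₗ[𝕜] W} (hf : HasShift π π' s f) (w : ℕ → 𝕜) (x : V) :
    f (weight π n (fun p => w (p + s)) x) = weight π' n' w (f x) := by
  rw [h.map_eq_sum f x, map_sum, weight, LinearMap.sum_apply, map_sum]
  refine Finset.sum_congr rfl fun p _ => ?_
  rw [LinearMap.smul_apply, map_smul, hf, h'.weight_proj]

lemma proj_apply_of_lt (h : IsDecomposition π n) (h' : IsDecomposition π' n') {s : ℕ}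
    {f : V →ₗ[𝕜] W} (hf : HasShift π π' s f) {p : ℕ} (hp : p < s) (x : V) : π' p (f x) = 0 := by
  rw [h.map_eq_sum f x, map_sum]
  refine Finset.sum_eq_zero fun q _ => ?_
  rw [hf, h'.proj_proj_of_ne (by omega)]

lemma proj_mem_map_of_hasShift (h : IsDecomposition π n) (h' : IsDecomposition π' n') {s : ℕ}
    {f : V →ₗ[𝕜] W} (hf : HasShift π π' s f) {K : Submodule 𝕜 V}
    (hK : ∀ p, ∀ x ∈ K, π p x ∈ K) (p : ℕ) : ∀ y ∈ K.map f, π' p y ∈ K.map f := by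
  rintro _ ⟨x, hx, rfl⟩
  rcases lt_or_ge p s with hp | hp
  · rw [h.proj_apply_of_lt h' hf hp]
    exact Submodule.zero_mem _
  · refine ⟨π (p - s) x, hK _ x hx, ?_⟩
    rw [hf, Nat.sub_add_cancel hp]

lemma hasShift_shiftPart (h : IsDecomposition π n) (h' : IsDecomposition π' n') (s : ℕ)
    (f : V →ₗ[𝕜] W) : HasShift π π' s (shiftPart π n π' s f) := by
  intro p x
  simp only [shiftPart, LinearMap.sum_apply, LinearMap.comp_apply, map_sum, h.proj_proj,
    h'.proj_proj, add_left_inj]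
  refine Finset.sum_congr rfl fun q _ => ?_
  by_cases hpq : p = q
  · simp [hpq]
  · simp [hpq, Ne.symm hpq]

lemma shiftPart_eq (h : IsDecomposition π n) (h' : IsDecomposition π' n') {s : ℕ}
    {f : V →ₗ[𝕜] W} (hf : HasShift π π' s f) (t : ℕ) :
    shiftPart π n π' t f = if t = s then f else 0 := by
  ext x
  simp only [shiftPart, LinearMap.sum_apply, LinearMap.comp_apply, hf _ x, h'.proj_proj,
    add_right_inj]
  split_ifs with hts
  · rw [hts]
    exact (Finset.sum_congr rfl fun p _ => (hf p x).symm).trans (h.map_eq_sum f x).symm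
  · exact Finset.sum_const_zero

lemma eq_zero_of_hasShift_of_add_add_eq_zero (h : IsDecomposition π n)
    (h' : IsDecomposition π' n') {f₀ f₁ f₂ : V →ₗ[𝕜] W} (hf₀ : HasShift π π' 0 f₀)
    (hf₁ : HasShift π π' 1 f₁) (hf₂ : HasShift π π' 2 f₂) (hsum : f₀ + f₁ + f₂ = 0) :
    f₀ = 0 ∧ f₁ = 0 ∧ f₂ = 0 := by
  have hpart (t : ℕ) :
      (if t = 0 then f₀ else 0) + (if t = 1 then f₁ else 0) + (if t = 2 then f₂ else 0) = 0 := by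
    rw [← h.shiftPart_eq h' hf₀, ← h.shiftPart_eq h' hf₁, ← h.shiftPart_eq h' hf₂,
      ← shiftPart_add, ← shiftPart_add, hsum, shiftPart_zero]
  exact ⟨by simpa using hpart 0, by simpa using hpart 1, by simpa using hpart 2⟩

lemma shiftPart_add_shiftPart (h : IsDecomposition π n) (h' : IsDecomposition π' n')
    {f : V →ₗ[𝕜] W} (hf : ∀ p q x, q ≠ p → q ≠ p + 1 → π' q (f (π p x)) = 0) :
    shiftPart π n π' 1 f + shiftPart π n π' 0 f = f := by
  ext x
  rw [h.map_eq_sum f x, LinearMap.add_apply]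
  simp only [shiftPart, LinearMap.sum_apply, LinearMap.comp_apply, add_zero,
    ← Finset.sum_add_distrib]
  refine Finset.sum_congr rfl fun p _ => h'.ext fun q => ?_
  rw [map_add, h'.proj_proj, h'.proj_proj]
  rcases eq_or_ne q p with rfl | hqp
  · simp
  · rcases eq_or_ne q (p + 1) with rfl | hqp'
    · simp
    · simp [hqp, hqp', hf p q x hqp hqp']

end IsDecomposition

lemma HasShift.comp {U : Type u} [AddCommGroup U] [Module 𝕜 U] {π : ℕ → V →ₗ[𝕜] V}
    {π' : ℕ → W →ₗ[𝕜] W} {π'' : ℕ → U →ₗ[𝕜] U} {s t : ℕ} {f : V →ₗ[𝕜] W} {g : W →ₗ[𝕜] U}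
    (hg : HasShift π' π'' t g) (hf : HasShift π π' s f) :
    HasShift π π'' (s + t) (g ∘ₗ f) := fun p x => by
  rw [LinearMap.comp_apply, hf, hg, LinearMap.comp_apply, add_assoc]

lemma HasShift.add {π : ℕ → V →ₗ[𝕜] V} {π' : ℕ → W →ₗ[𝕜] W} {s : ℕ} {f g : V →ₗ[𝕜] W}
    (hf : HasShift π π' s f) (hg : HasShift π π' s g) : HasShift π π' s (f + g) := fun p x => by
  rw [LinearMap.add_apply, hf, hg, LinearMap.add_apply, map_add]

lemma HasShift.proj_mem_ker {π : ℕ → V →ₗ[𝕜] V} {π' : ℕ → W →ₗ[𝕜] W} {s : ℕ} {f : V →ₗ[𝕜] W}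
    (hf : HasShift π π' s f) (p : ℕ) : ∀ x ∈ LinearMap.ker f, π p x ∈ LinearMap.ker f :=
  fun x hx => by rw [LinearMap.mem_ker, hf, LinearMap.mem_ker.1 hx, map_zero]

end Decompositions

section DoubleComplexes
universe u
variable {𝕜 : Type*} [Field 𝕜] {A : ℕ → Type u} [∀ k, AddCommGroup (A k)] [∀ k, Module 𝕜 (A k)]

/-- The degree `k` part of the image of a map of degree one; it is `0` for `k = 0`. -/
def imDeg (f : ∀ k, A k →ₗ[𝕜] A (k + 1)) : (k : ℕ) → Submodule 𝕜 (A k)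
  | 0 => ⊥
  | k + 1 => LinearMap.range (f k)

lemma imDeg_le {f : ∀ k, A k →ₗ[𝕜] A (k + 1)} {S : ∀ k, Submodule 𝕜 (A k)}
    (h : ∀ k x, f k x ∈ S (k + 1)) (k : ℕ) : imDeg f k ≤ S k := by
  cases k with
  | zero => exact bot_le
  | succ k => exact LinearMap.range_le_iff_comap.2 (top_unique fun x _ => h k x)

variable (𝕜 A) in
/-- A double complex, given by its total complex `(A, d)` and the projections `proj k p` of `A k`
onto the component of bidegree `(p, k - p)`, for `p ≤ k`. -/
structure DoubleComplex where
  d : ∀ k, A k →ₗ[𝕜] A (k + 1)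
  del : ∀ k, A k →ₗ[𝕜] A (k + 1)
  delbar : ∀ k, A k →ₗ[𝕜] A (k + 1)
  proj : ∀ k, ℕ → A k →ₗ[𝕜] A k
  isDecomposition : ∀ k, IsDecomposition (proj k) (k + 1)
  del_proj : ∀ k, HasShift (proj k) (proj (k + 1)) 1 (del k)
  delbar_proj : ∀ k, HasShift (proj k) (proj (k + 1)) 0 (delbar k)
  d_apply : ∀ k x, d k x = del k x + delbar k x
  del_del : ∀ k x, del (k + 1) (del k x) = 0
  delbar_delbar : ∀ k x, delbar (k + 1) (delbar k x) = 0
  delbar_del : ∀ k x, delbar (k + 1) (del k x) = -del (k + 1) (delbar k x)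

namespace DoubleComplex

/-- The double complex of a differential which raises one of the two degrees by one. The maps
`del` and `delbar` are arguments so that they may be given in another form. -/
def ofDifferential (d del delbar : ∀ k, A k →ₗ[𝕜] A (k + 1)) (proj : ∀ k, ℕ → A k →ₗ[𝕜] A k)
    (isDecomposition : ∀ k, IsDecomposition (proj k) (k + 1))
    (d_d : ∀ k x, d (k + 1) (d k x) = 0)
    (proj_d_proj : ∀ k p q x, q ≠ p → q ≠ p + 1 → proj (k + 1) q (d k (proj k p x)) = 0)
    (del_eq : ∀ k, del k = shiftPart (proj k) (k + 1) (proj (k + 1)) 1 (d k))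
    (delbar_eq : ∀ k, delbar k = shiftPart (proj k) (k + 1) (proj (k + 1)) 0 (d k)) :
    DoubleComplex 𝕜 A :=
  have del_proj k : HasShift (proj k) (proj (k + 1)) 1 (del k) :=
    del_eq k ▸ (isDecomposition k).hasShift_shiftPart (isDecomposition (k + 1)) 1 (d k)
  have delbar_proj k : HasShift (proj k) (proj (k + 1)) 0 (delbar k) :=
    delbar_eq k ▸ (isDecomposition k).hasShift_shiftPart (isDecomposition (k + 1)) 0 (d k)
  have d_eq k : d k = del k + delbar k := by
    rw [del_eq, delbar_eq, (isDecomposition k).shiftPart_add_shiftPart (isDecomposition (k + 1))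
      (proj_d_proj k)]
  have components k : delbar (k + 1) ∘ₗ delbar k = 0 ∧
      delbar (k + 1) ∘ₗ del k + del (k + 1) ∘ₗ delbar k = 0 ∧ del (k + 1) ∘ₗ del k = 0 := by
    refine (isDecomposition k).eq_zero_of_hasShift_of_add_add_eq_zero (isDecomposition (k + 2))
      ((delbar_proj (k + 1)).comp (delbar_proj k)) (((delbar_proj (k + 1)).comp (del_proj k)).add
        ((del_proj (k + 1)).comp (delbar_proj k))) ((del_proj (k + 1)).comp (del_proj k)) ?_
    ext x
    rw [LinearMap.zero_apply, ← d_d k x, d_eq, d_eq]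
    simp only [LinearMap.add_apply, LinearMap.comp_apply, map_add]
    abel
  { d, del, delbar, proj, isDecomposition, del_proj, delbar_proj
    d_apply := fun k x => LinearMap.congr_fun (d_eq k) x
    del_del := fun k x => LinearMap.congr_fun (components k).2.2 x
    delbar_delbar := fun k x => LinearMap.congr_fun (components k).1 x
    delbar_del := fun k x =>
      eq_neg_of_add_eq_zero_left (LinearMap.congr_fun (components k).2.1 x) }

variable (C : DoubleComplex 𝕜 A) (k : ℕ)

/-- The cocycles of the total complex. -/
def closed : Submodule 𝕜 (A k) := LinearMap.ker (C.d k)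

/-- The coboundaries of the total complex. -/
def exact : Submodule 𝕜 (A k) := imDeg C.d k

/-- The numerator `Ker ∂ ∩ Ker ∂̄` of the Bott-Chern cohomology. -/
def bottChernCycles : Submodule 𝕜 (A k) := LinearMap.ker (C.del k) ⊓ LinearMap.ker (C.delbar k)

/-- The denominator `Im ∂∂̄` of the Bott-Chern cohomology. -/
def imDelDelbar : (k : ℕ) → Submodule 𝕜 (A k)
  | 0 => ⊥
  | k + 1 => (imDeg C.delbar k).map (C.del k)

/-- The numerator `Ker ∂∂̄` of the Aeppli cohomology. -/
def aeppliCycles : Submodule 𝕜 (A k) := LinearMap.ker (C.del (k + 1) ∘ₗ C.delbar k)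

/-- The denominator `Im ∂ + Im ∂̄` of the Aeppli cohomology. -/
def aeppliBoundaries : Submodule 𝕜 (A k) := imDeg C.del k ⊔ imDeg C.delbar k

/-- The dimension of `(Ker ∂ ∩ Ker ∂̄ ∩ Im d) / Im ∂∂̄` in degree `k`, which measures the failure of
the `∂∂̄`-lemma. -/
def delDelbarDefect : Cardinal :=
  relRank (C.bottChernCycles k ⊓ C.exact k) (C.imDelDelbar k)

variable {C k}

lemma mem_closed {x : A k} : x ∈ C.closed k ↔ C.d k x = 0 := Iff.rfl

lemma mem_bottChernCycles {x : A k} :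
    x ∈ C.bottChernCycles k ↔ C.del k x = 0 ∧ C.delbar k x = 0 := Iff.rfl

lemma mem_aeppliCycles {x : A k} :
    x ∈ C.aeppliCycles k ↔ C.del (k + 1) (C.delbar k x) = 0 := Iff.rfl

lemma d_mem_exact (x : A k) : C.d k x ∈ C.exact (k + 1) := ⟨x, rfl⟩

lemma del_mem_aeppliBoundaries (x : A k) : C.del k x ∈ C.aeppliBoundaries (k + 1) :=
  Submodule.mem_sup_left ⟨x, rfl⟩

lemma delbar_mem_aeppliBoundaries (x : A k) : C.delbar k x ∈ C.aeppliBoundaries (k + 1) :=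
  Submodule.mem_sup_right ⟨x, rfl⟩

lemma delbar_eq_neg_del {x : A k} (hx : x ∈ C.closed k) : C.delbar k x = -C.del k x :=
  eq_neg_of_add_eq_zero_right (C.d_apply k x ▸ hx)

lemma imDeg_del_le_ker (k : ℕ) : imDeg C.del k ≤ LinearMap.ker (C.del k) :=
  imDeg_le (S := fun k => LinearMap.ker (C.del k)) C.del_del k

lemma imDeg_delbar_le_ker (k : ℕ) : imDeg C.delbar k ≤ LinearMap.ker (C.delbar k) :=
  imDeg_le (S := fun k => LinearMap.ker (C.delbar k)) C.delbar_delbar k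

lemma d_eq_del_of_mem_imDeg_delbar {x : A k} (hx : x ∈ imDeg C.delbar k) :
    C.d k x = C.del k x := by
  rw [C.d_apply, LinearMap.mem_ker.1 (imDeg_delbar_le_ker k hx), add_zero]

lemma bottChernCycles_le_closed : C.bottChernCycles k ≤ C.closed k := fun x hx => by
  rw [mem_closed, C.d_apply, hx.1, hx.2, add_zero]

lemma d_del (x : A k) : C.d (k + 1) (C.del k x) = -C.del (k + 1) (C.delbar k x) := by
  rw [C.d_apply, C.del_del, C.delbar_del, zero_add]

lemma d_delbar (x : A k) : C.d (k + 1) (C.delbar k x) = C.del (k + 1) (C.delbar k x) := by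
  rw [C.d_apply, C.delbar_delbar, add_zero]

lemma exact_le_closed (k : ℕ) : C.exact k ≤ C.closed k :=
  imDeg_le (S := C.closed) (fun k x => by
    rw [mem_closed, C.d_apply k x, map_add, d_del, d_delbar, neg_add_cancel]) k

lemma exact_le_aeppliBoundaries (k : ℕ) : C.exact k ≤ C.aeppliBoundaries k :=
  imDeg_le (S := C.aeppliBoundaries) (fun k x => by
    rw [C.d_apply]
    exact add_mem (del_mem_aeppliBoundaries x) (delbar_mem_aeppliBoundaries x)) k

lemma closed_le_aeppliCycles : C.closed k ≤ C.aeppliCycles k := fun x hx => by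
  rw [mem_aeppliCycles, delbar_eq_neg_del hx, map_neg, C.del_del, neg_zero]

lemma aeppliBoundaries_le_aeppliCycles (k : ℕ) : C.aeppliBoundaries k ≤ C.aeppliCycles k := by
  refine sup_le (imDeg_le (S := C.aeppliCycles) (fun k x => ?_) k)
    (imDeg_le (S := C.aeppliCycles) (fun k x => ?_) k)
  · rw [mem_aeppliCycles, C.delbar_del, map_neg, C.del_del, neg_zero]
  · rw [mem_aeppliCycles, C.delbar_delbar, map_zero]

lemma imDelDelbar_le (k : ℕ) : C.imDelDelbar k ≤ C.bottChernCycles k ⊓ C.exact k := by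
  cases k with
  | zero => exact bot_le
  | succ k =>
    rintro _ ⟨b, hb, rfl⟩
    have hdelbar : C.delbar k b = 0 := imDeg_delbar_le_ker k hb
    refine ⟨⟨C.del_del k b, ?_⟩, b, d_eq_del_of_mem_imDeg_delbar hb⟩
    rw [SetLike.mem_coe, LinearMap.mem_ker, C.delbar_del, hdelbar, map_zero, neg_zero]

lemma imDelDelbar_succ_le_map_exact (k : ℕ) :
    C.imDelDelbar (k + 1) ≤ (C.exact k).map (C.del k) := by
  refine Submodule.map_le_iff_le_comap.2
    (imDeg_le (S := fun k => ((C.exact k).map (C.del k)).comap (C.del k)) (fun k x => ?_) k)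
  refine ⟨C.d k x, d_mem_exact x, ?_⟩
  rw [C.d_apply, map_add, C.del_del, zero_add]

lemma d_mem_imDelDelbar {x : A k} (hx : x ∈ C.aeppliBoundaries k) :
    C.d k x ∈ C.imDelDelbar (k + 1) := by
  suffices h : C.aeppliBoundaries k ≤ (C.imDelDelbar (k + 1)).comap (C.d k) from h hx
  have hmem (k : ℕ) (x : A k) : C.del (k + 1) (C.delbar k x) ∈ C.imDelDelbar (k + 2) :=
    ⟨C.delbar k x, ⟨x, rfl⟩, rfl⟩
  refine sup_le
    (imDeg_le (S := fun k => (C.imDelDelbar (k + 1)).comap (C.d k)) (fun k x => ?_) k)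
    (imDeg_le (S := fun k => (C.imDelDelbar (k + 1)).comap (C.d k)) (fun k x => ?_) k)
  · rw [Submodule.mem_comap, d_del]
    exact neg_mem (hmem k x)
  · rw [Submodule.mem_comap, d_delbar]
    exact hmem k x

lemma del_weight_of_mem_closed {z : A k} (hz : z ∈ C.closed k) (v : ℕ → 𝕜) :
    C.del k (weight (C.proj k) (k + 1) v z) =
      -C.d k (weight (C.proj k) (k + 1) (fun p => ∑ i ∈ Finset.range p, v i) z) := by
  set u : ℕ → 𝕜 := fun p => ∑ i ∈ Finset.range p, v i
  set W := weight (C.proj k) (k + 1)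
  have hv : v = (fun p => u (p + 1)) - u := funext fun p => by
    simp [u, Finset.sum_range_succ]
  have hdel : C.del k (W (fun p => u (p + 1)) z) = weight (C.proj (k + 1)) (k + 2) u (C.del k z) :=
    (C.isDecomposition k).map_weight_of_hasShift (C.isDecomposition (k + 1)) (C.del_proj k) u z
  have hdelbar : C.delbar k (W u z) = weight (C.proj (k + 1)) (k + 2) u (C.delbar k z) :=
    (C.isDecomposition k).map_weight_of_hasShift (C.isDecomposition (k + 1)) (C.delbar_proj k) u z
  have hWv : W v z = W (fun p => u (p + 1)) z - W u z := by
    rw [hv]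
    simp [W, weight, sub_smul]
  rw [C.d_apply, hWv, map_sub, hdel, hdelbar, delbar_eq_neg_del hz, map_neg]
  abel

lemma exists_d_eq_del_and_del_mem_exact {z : A k} (hz : z ∈ C.closed k) :
    ∃ w, C.d k w = C.del k z ∧ C.del k w ∈ C.exact (k + 1) := by
  have hone : weight (C.proj k) (k + 1) 1 z = z := by
    simpa [weight] using (C.isDecomposition k).sum_proj z
  have hdel := del_weight_of_mem_closed hz 1
  rw [hone] at hdel
  refine ⟨-weight (C.proj k) (k + 1) (fun p => ∑ i ∈ Finset.range p, (1 : ℕ → 𝕜) i) z, ?_, ?_⟩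
  · rw [map_neg, hdel]
  · rw [map_neg, del_weight_of_mem_closed hz, neg_neg]
    exact d_mem_exact _

lemma del_mem_exact {x : A k} (hx : x ∈ C.closed k ⊔ C.aeppliBoundaries k) :
    C.del k x ∈ C.exact (k + 1) := by
  suffices h : C.closed k ⊔ C.aeppliBoundaries k ≤ (C.exact (k + 1)).comap (C.del k) from h hx
  refine sup_le (fun z hz => ?_) (sup_le (fun x hx => ?_)
    (imDeg_le (S := fun k => (C.exact (k + 1)).comap (C.del k)) (fun k x => ?_) k))
  · obtain ⟨w, hw, -⟩ := exists_d_eq_del_and_del_mem_exact hz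
    exact ⟨w, hw⟩
  · rw [Submodule.mem_comap, LinearMap.mem_ker.1 (imDeg_del_le_ker k hx)]
    exact Submodule.zero_mem _
  · exact ⟨C.delbar k x, d_delbar x⟩

lemma del_mem_bottChernCycles_inf_exact {z : A k} (hz : z ∈ C.closed k) :
    C.del k z ∈ C.bottChernCycles (k + 1) ⊓ C.exact (k + 1) := by
  refine ⟨⟨C.del_del k z, ?_⟩, del_mem_exact (Submodule.mem_sup_left hz)⟩
  rw [SetLike.mem_coe, LinearMap.mem_ker, C.delbar_del, neg_eq_zero]
  exact closed_le_aeppliCycles hz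

lemma mem_bottChernCycles_sup_exact {z : A k} (hz : z ∈ C.closed k)
    (hdel : C.del k z ∈ C.imDelDelbar (k + 1)) : z ∈ C.bottChernCycles k ⊔ C.exact k := by
  obtain ⟨c, hc, hcz⟩ := imDelDelbar_succ_le_map_exact k hdel
  have hclosed : z - c ∈ C.closed k := sub_mem hz (exact_le_closed k hc)
  have hdel_sub : C.del k (z - c) = 0 := by rw [map_sub, hcz, sub_self]
  have hcycle : z - c ∈ C.bottChernCycles k :=
    ⟨hdel_sub, by rw [SetLike.mem_coe, LinearMap.mem_ker, delbar_eq_neg_del hclosed, hdel_sub,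
      neg_zero]⟩
  simpa using Submodule.add_mem_sup hcycle hc

lemma d_mem_bottChernCycles {x : A k} (hx : x ∈ C.aeppliCycles k) :
    C.d k x ∈ C.bottChernCycles (k + 1) := by
  rw [mem_bottChernCycles, C.d_apply, map_add, map_add, C.del_del, C.delbar_del,
    C.delbar_delbar, mem_aeppliCycles.1 hx]
  simp

lemma del_mem_closed_inf_aeppliBoundaries {x : A k} (hx : x ∈ C.aeppliCycles k) :
    C.del k x ∈ C.closed (k + 1) ⊓ C.aeppliBoundaries (k + 1) :=
  ⟨by rw [SetLike.mem_coe, mem_closed, d_del, mem_aeppliCycles.1 hx, neg_zero],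
    del_mem_aeppliBoundaries x⟩

lemma exists_sub_del_mem_exact {y : A (k + 1)}
    (hy : y ∈ C.closed (k + 1) ⊓ C.aeppliBoundaries (k + 1)) :
    ∃ x ∈ C.aeppliCycles k, y - C.del k x ∈ C.exact (k + 1) := by
  obtain ⟨hclosed, hy⟩ := hy
  obtain ⟨_, ⟨a, rfl⟩, _, ⟨b, rfl⟩, rfl⟩ := Submodule.mem_sup.1 hy
  refine ⟨a - b, ?_, b, ?_⟩
  · have hd := mem_closed.1 hclosed
    rw [map_add, d_del, d_delbar, neg_add_eq_sub, sub_eq_zero] at hd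
    rw [mem_aeppliCycles, map_sub, map_sub, hd, sub_self]
  · rw [C.d_apply, map_sub]
    abel

lemma relRank_closed_bottChernCycles_sup_exact_le (C : DoubleComplex 𝕜 A) (k : ℕ) :
    relRank (C.closed k) (C.bottChernCycles k ⊔ C.exact k) ≤ C.delDelbarDefect (k + 1) :=
  relRank_le_of_injective (C.del k) (fun _ hz => del_mem_bottChernCycles_inf_exact hz)
    fun _ hz hdel => mem_bottChernCycles_sup_exact hz hdel

lemma relRank_aeppliCycles_closed_sup (C : DoubleComplex 𝕜 A) (k : ℕ) :
    relRank (C.aeppliCycles k) (C.closed k ⊔ C.aeppliBoundaries k) =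
      C.delDelbarDefect (k + 1) := by
  have hmaps : ∀ x ∈ C.aeppliCycles k, C.d k x ∈ C.bottChernCycles (k + 1) ⊓ C.exact (k + 1) :=
    fun x hx => ⟨d_mem_bottChernCycles hx, d_mem_exact x⟩
  refine le_antisymm (relRank_le_of_injective (C.d k) hmaps ?_)
    (relRank_le_of_surjective (C.d k) hmaps ?_ ?_)
  · rintro x - ⟨b, hb, hbx⟩
    have hclosed : x - b ∈ C.closed k := by
      rw [mem_closed, map_sub, d_eq_del_of_mem_imDeg_delbar hb, hbx, sub_self]
    have hb' : b ∈ C.aeppliBoundaries k := Submodule.mem_sup_right hb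
    simpa using Submodule.add_mem_sup hclosed hb'
  · rintro x - hx
    obtain ⟨c, hc, a, ha, rfl⟩ := Submodule.mem_sup.1 hx
    rw [map_add, mem_closed.1 hc, zero_add]
    exact d_mem_imDelDelbar ha
  · rintro _ ⟨hcycle, x, rfl⟩
    refine ⟨x, ?_, by simp⟩
    rw [mem_aeppliCycles, ← hcycle.1, C.d_apply, map_add, C.del_del, zero_add]

lemma relRank_closed_inf_aeppliBoundaries_le (C : DoubleComplex 𝕜 A) (k : ℕ) :
    relRank (C.closed k ⊓ C.aeppliBoundaries k) (C.exact k) ≤ C.delDelbarDefect k := by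
  cases k with
  | zero =>
    have hbot : C.closed 0 ⊓ C.aeppliBoundaries 0 ≤ C.exact 0 := by
      simp [aeppliBoundaries, imDeg]
    rw [relRank_eq_zero_iff.2 hbot]
    exact zero_le
  | succ k =>
    rw [← relRank_aeppliCycles_closed_sup]
    exact relRank_le_of_surjective (C.del k)
      (fun _ hx => del_mem_closed_inf_aeppliBoundaries hx) (fun _ _ hx => del_mem_exact hx)
      fun _ hy => exists_sub_del_mem_exact hy

lemma relRank_bottChern_eq_add (C : DoubleComplex 𝕜 A) (k : ℕ) :
    relRank (C.bottChernCycles k) (C.imDelDelbar k) =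
      relRank (C.bottChernCycles k) (C.exact k) + C.delDelbarDefect k := by
  rw [relRank_eq_add (imDelDelbar_le k) inf_le_left, relRank_inf, delDelbarDefect]

lemma relRank_aeppli_eq_add (C : DoubleComplex 𝕜 A) (k : ℕ) :
    relRank (C.aeppliCycles k) (C.aeppliBoundaries k) =
      C.delDelbarDefect (k + 1) + relRank (C.closed k) (C.aeppliBoundaries k) := by
  rw [relRank_eq_add le_sup_right (sup_le closed_le_aeppliCycles
    (aeppliBoundaries_le_aeppliCycles k)), relRank_aeppliCycles_closed_sup, relRank_sup]

lemma relRank_closed_exact_eq_add_bottChern (C : DoubleComplex 𝕜 A) (k : ℕ) :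
    relRank (C.closed k) (C.exact k) =
      relRank (C.closed k) (C.bottChernCycles k ⊔ C.exact k) +
        relRank (C.bottChernCycles k) (C.exact k) := by
  rw [relRank_eq_add le_sup_right (sup_le bottChernCycles_le_closed (exact_le_closed k)),
    relRank_sup]

lemma relRank_closed_exact_eq_add_aeppli (C : DoubleComplex 𝕜 A) (k : ℕ) :
    relRank (C.closed k) (C.exact k) = relRank (C.closed k) (C.aeppliBoundaries k) +
      relRank (C.closed k ⊓ C.aeppliBoundaries k) (C.exact k) := by
  rw [relRank_eq_add (le_inf (exact_le_closed k) (exact_le_aeppliBoundaries k)) inf_le_left,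
    relRank_inf]

lemma two_mul_relRank_closed_exact (C : DoubleComplex 𝕜 A) (k : ℕ) :
    2 * relRank (C.closed k) (C.exact k) =
      relRank (C.closed k) (C.bottChernCycles k ⊔ C.exact k) +
        relRank (C.closed k ⊓ C.aeppliBoundaries k) (C.exact k) +
      (relRank (C.bottChernCycles k) (C.exact k) +
        relRank (C.closed k) (C.aeppliBoundaries k)) := by
  rw [two_mul]
  nth_rw 1 [relRank_closed_exact_eq_add_bottChern]
  rw [relRank_closed_exact_eq_add_aeppli]
  ring

lemma relRank_bottChern_add_relRank_aeppli (C : DoubleComplex 𝕜 A) (k : ℕ) :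
    relRank (C.bottChernCycles k) (C.imDelDelbar k) +
        relRank (C.aeppliCycles k) (C.aeppliBoundaries k) =
      C.delDelbarDefect (k + 1) + C.delDelbarDefect k +
      (relRank (C.bottChernCycles k) (C.exact k) +
        relRank (C.closed k) (C.aeppliBoundaries k)) := by
  rw [relRank_bottChern_eq_add, relRank_aeppli_eq_add]
  ring

theorem two_mul_relRank_closed_exact_le (C : DoubleComplex 𝕜 A) (k : ℕ) :
    2 * relRank (C.closed k) (C.exact k) ≤ relRank (C.bottChernCycles k) (C.imDelDelbar k) +
      relRank (C.aeppliCycles k) (C.aeppliBoundaries k) := by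
  rw [two_mul_relRank_closed_exact, relRank_bottChern_add_relRank_aeppli]
  gcongr
  · exact C.relRank_closed_bottChernCycles_sup_exact_le k
  · exact C.relRank_closed_inf_aeppliBoundaries_le k

theorem relRank_bottChern_add_relRank_aeppli_of_inf_eq
    (h : ∀ k, C.bottChernCycles k ⊓ C.exact k = C.imDelDelbar k) (k : ℕ) :
    relRank (C.bottChernCycles k) (C.imDelDelbar k) +
        relRank (C.aeppliCycles k) (C.aeppliBoundaries k) =
      2 * relRank (C.closed k) (C.exact k) := by
  have hzero k : C.delDelbarDefect k = 0 := relRank_eq_zero_iff.2 (h k).le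
  have hbc := C.relRank_closed_bottChernCycles_sup_exact_le k
  have haeppli := C.relRank_closed_inf_aeppliBoundaries_le k
  rw [hzero, nonpos_iff_eq_zero] at hbc haeppli
  rw [two_mul_relRank_closed_exact, relRank_bottChern_add_relRank_aeppli, hbc, haeppli, hzero,
    hzero]

lemma delDelbarDefect_le_of_relRank_add_eq
    (hfin : relRank (C.closed k) (C.exact k) < Cardinal.aleph0)
    (heq : relRank (C.bottChernCycles k) (C.imDelDelbar k) +
      relRank (C.aeppliCycles k) (C.aeppliBoundaries k) =
        2 * relRank (C.closed k) (C.exact k)) :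
    C.delDelbarDefect (k + 1) ≤ relRank (C.closed k) (C.bottChernCycles k ⊔ C.exact k) ∧
      C.delDelbarDefect k ≤ relRank (C.closed k ⊓ C.aeppliBoundaries k) (C.exact k) := by
  have hbc := C.relRank_closed_bottChernCycles_sup_exact_le k
  have haeppli := C.relRank_closed_inf_aeppliBoundaries_le k
  have htwo : 2 * relRank (C.closed k) (C.exact k) < Cardinal.aleph0 :=
    Cardinal.mul_lt_aleph0 Cardinal.ofNat_lt_aleph0 hfin
  have hsum : C.delDelbarDefect (k + 1) + C.delDelbarDefect k =
      relRank (C.closed k) (C.bottChernCycles k ⊔ C.exact k) +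
        relRank (C.closed k ⊓ C.aeppliBoundaries k) (C.exact k) := by
    have hrest := htwo
    rw [two_mul_relRank_closed_exact] at hrest heq
    rw [relRank_bottChern_add_relRank_aeppli] at heq
    exact Cardinal.eq_of_add_eq_add_right heq (le_add_self.trans_lt hrest)
  have hdefects : C.delDelbarDefect (k + 1) + C.delDelbarDefect k < Cardinal.aleph0 := by
    rw [← heq, relRank_bottChern_add_relRank_aeppli] at htwo
    exact le_self_add.trans_lt htwo
  obtain ⟨hfin_succ, hfin_self⟩ := Cardinal.add_lt_aleph0_iff.1 hdefects
  refine ⟨(Cardinal.add_le_add_iff_of_lt_aleph0 hfin_self).1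
    (hsum.trans_le (add_le_add_right haeppli _)), ?_⟩
  refine (Cardinal.add_le_add_iff_of_lt_aleph0 hfin_succ).1 ?_
  rw [add_comm, hsum, add_comm]
  exact add_le_add_right hbc _

lemma exists_sub_del_mem_imDelDelbar (hlt : C.delDelbarDefect (k + 1) < Cardinal.aleph0)
    (hle : C.delDelbarDefect (k + 1) ≤ relRank (C.closed k) (C.bottChernCycles k ⊔ C.exact k))
    {y : A (k + 1)} (hy : y ∈ C.bottChernCycles (k + 1) ⊓ C.exact (k + 1)) :
    ∃ z ∈ C.closed k, y - C.del k z ∈ C.imDelDelbar (k + 1) :=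
  surjective_of_injective_of_relRank_le (C.del k)
    (fun _ hz => del_mem_bottChernCycles_inf_exact hz)
    (fun _ hz => mem_bottChernCycles_sup_exact hz) (imDelDelbar_le (k + 1)) hlt hle y hy

lemma mem_closed_sup_aeppliBoundaries (hlt : C.delDelbarDefect (k + 1) < Cardinal.aleph0)
    (hle : C.delDelbarDefect (k + 1) ≤
      relRank (C.closed (k + 1) ⊓ C.aeppliBoundaries (k + 1)) (C.exact (k + 1)))
    {x : A k} (hx : x ∈ C.aeppliCycles k) (hdel : C.del k x ∈ C.exact (k + 1)) :
    x ∈ C.closed k ⊔ C.aeppliBoundaries k := by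
  rw [← relRank_aeppliCycles_closed_sup] at hlt hle
  exact injective_of_surjective_of_relRank_le (C.del k)
    (fun _ hx => del_mem_closed_inf_aeppliBoundaries hx) (fun _ hx => del_mem_exact hx)
    (fun _ hy => exists_sub_del_mem_exact hy)
    (sup_le closed_le_aeppliCycles (aeppliBoundaries_le_aeppliCycles k)) hlt hle x hx hdel

theorem inf_eq_of_relRank_bottChern_add_relRank_aeppli
    (hfin : ∀ k, relRank (C.closed k) (C.exact k) < Cardinal.aleph0)
    (heq : ∀ k, relRank (C.bottChernCycles k) (C.imDelDelbar k) +
      relRank (C.aeppliCycles k) (C.aeppliBoundaries k) =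
        2 * relRank (C.closed k) (C.exact k)) (k : ℕ) :
    C.bottChernCycles k ⊓ C.exact k = C.imDelDelbar k := by
  refine le_antisymm ?_ (imDelDelbar_le k)
  cases k with
  | zero => exact inf_le_right
  | succ k =>
    have hle_bc := (delDelbarDefect_le_of_relRank_add_eq (hfin k) (heq k)).1
    have hle_aeppli := (delDelbarDefect_le_of_relRank_add_eq (hfin (k + 1)) (heq (k + 1))).2
    have hlt : C.delDelbarDefect (k + 1) < Cardinal.aleph0 := by
      refine hle_bc.trans_lt (lt_of_le_of_lt ?_ (hfin k))
      rw [relRank_closed_exact_eq_add_bottChern]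
      exact le_self_add
    intro y hy
    obtain ⟨z, hz, hyz⟩ := exists_sub_del_mem_imDelDelbar hlt hle_bc hy
    obtain ⟨w, hw, hdelw⟩ := exists_d_eq_del_and_del_mem_exact hz
    have hw_cycle : w ∈ C.aeppliCycles k := by
      have hdel : C.del (k + 1) (C.d k w) = 0 := by rw [hw, C.del_del]
      rwa [C.d_apply, map_add, C.del_del, zero_add] at hdel
    obtain ⟨c, hc, a, ha, rfl⟩ := Submodule.mem_sup.1
      (mem_closed_sup_aeppliBoundaries hlt hle_aeppli hw_cycle hdelw)
    have hdelz : C.del k z ∈ C.imDelDelbar (k + 1) := by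
      rw [← hw, map_add, mem_closed.1 hc, zero_add]
      exact d_mem_imDelDelbar ha
    simpa using add_mem hyz hdelz

lemma proj_mem_imDeg {s : ℕ} {f : ∀ k, A k →ₗ[𝕜] A (k + 1)}
    (hf : ∀ k, HasShift (C.proj k) (C.proj (k + 1)) s (f k)) (k p : ℕ) :
    ∀ x ∈ imDeg f k, C.proj k p x ∈ imDeg f k :=
  imDeg_le (S := fun k => (imDeg f k).comap (C.proj k p)) (fun k x => by
    have hmem := (C.isDecomposition k).proj_mem_map_of_hasShift (C.isDecomposition (k + 1)) (hf k)
      (K := ⊤) (fun _ _ _ => trivial) p (f k x) ⟨x, trivial, rfl⟩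
    rwa [Submodule.map_top] at hmem) k

lemma proj_mem_imDelDelbar (k p : ℕ) :
    ∀ x ∈ C.imDelDelbar k, C.proj k p x ∈ C.imDelDelbar k := by
  cases k with
  | zero =>
    intro x hx
    rw [(Submodule.mem_bot 𝕜).1 hx, map_zero]
    exact Submodule.zero_mem _
  | succ k =>
    exact (C.isDecomposition k).proj_mem_map_of_hasShift (C.isDecomposition (k + 1))
      (C.del_proj k) (proj_mem_imDeg C.delbar_proj k) p

lemma proj_mem_aeppliBoundaries (k p : ℕ) :
    ∀ x ∈ C.aeppliBoundaries k, C.proj k p x ∈ C.aeppliBoundaries k := fun x hx => by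
  obtain ⟨a, ha, b, hb, rfl⟩ := Submodule.mem_sup.1 hx
  rw [map_add]
  exact Submodule.add_mem_sup (proj_mem_imDeg C.del_proj k p a ha)
    (proj_mem_imDeg C.delbar_proj k p b hb)

theorem relRank_bottChern_eq_sum (C : DoubleComplex 𝕜 A) (k : ℕ) :
    relRank (C.bottChernCycles k) (C.imDelDelbar k) = ∑ p ∈ Finset.range (k + 1),
      relRank (LinearMap.range (C.proj k p) ⊓ C.bottChernCycles k) (C.imDelDelbar k) :=
  (C.isDecomposition k).relRank_eq_sum
    (fun p x hx => ⟨(C.del_proj k).proj_mem_ker p x hx.1, (C.delbar_proj k).proj_mem_ker p x hx.2⟩)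
    (proj_mem_imDelDelbar k)

theorem relRank_aeppli_eq_sum (C : DoubleComplex 𝕜 A) (k : ℕ) :
    relRank (C.aeppliCycles k) (C.aeppliBoundaries k) = ∑ p ∈ Finset.range (k + 1),
      relRank (LinearMap.range (C.proj k p) ⊓ C.aeppliCycles k) (C.aeppliBoundaries k) :=
  (C.isDecomposition k).relRank_eq_sum
    ((C.del_proj (k + 1)).comp (C.delbar_proj k)).proj_mem_ker (proj_mem_aeppliBoundaries k)

lemma delbar_proj_eq_zero {m : ℕ} {x : A k} (hx : x ∈ C.closed k)
    (hx' : x ∈ filtration (C.proj k) m) : C.delbar k (C.proj k m x) = 0 := by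
  have hdel : C.proj (k + 1) m (C.del k x) = 0 := by
    rw [(C.isDecomposition k).map_eq_sum (C.del k), map_sum]
    refine Finset.sum_eq_zero fun p _ => ?_
    rcases lt_or_ge p m with hp | hp
    · rw [mem_filtration.1 hx' p hp, map_zero, map_zero]
    · rw [C.del_proj, (C.isDecomposition (k + 1)).proj_proj_of_ne (by omega)]
  rw [C.delbar_proj, delbar_eq_neg_del hx, map_neg, add_zero, hdel, neg_zero]

lemma imDeg_delbar_le_comap_map_exact (k m : ℕ) : imDeg C.delbar k ≤
    ((C.exact k ⊓ filtration (C.proj k) m).map (C.proj k m)).comap (C.proj k m) := by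
  refine imDeg_le (S := fun k =>
    ((C.exact k ⊓ filtration (C.proj k) m).map (C.proj k m)).comap (C.proj k m)) (fun k y => ?_) k
  have h' := C.isDecomposition (k + 1)
  have hd : C.d k (C.proj k m y) =
      C.proj (k + 1) (m + 1) (C.del k y) + C.proj (k + 1) m (C.delbar k y) := by
    rw [C.d_apply, C.del_proj, C.delbar_proj, add_zero]
  refine ⟨C.d k (C.proj k m y), ⟨d_mem_exact _, mem_filtration.2 fun p hp => ?_⟩, ?_⟩
  · rw [hd, map_add, h'.proj_proj_of_ne (by omega), h'.proj_proj_of_ne hp.ne, add_zero]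
  · rw [hd, map_add, h'.proj_proj_of_ne (by omega), h'.proj_proj_self, zero_add]

lemma mem_filtration_succ_sup_exact {m : ℕ} {x : A k} (hx : x ∈ C.closed k)
    (hx' : x ∈ filtration (C.proj k) m) (hm : C.proj k m x ∈ imDeg C.delbar k) :
    x ∈ C.closed k ⊓ filtration (C.proj k) (m + 1) ⊔ C.exact k := by
  obtain ⟨e, ⟨he, he'⟩, hem⟩ := imDeg_delbar_le_comap_map_exact k m hm
  rw [(C.isDecomposition k).proj_proj_self] at hem
  have hsub := (C.isDecomposition k).sub_proj_mem_filtration (sub_mem hx' he')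
  rw [map_sub, hem, sub_self, sub_zero] at hsub
  have hclosed : x - e ∈ C.closed k := sub_mem hx (exact_le_closed k he)
  simpa using Submodule.add_mem_sup (Submodule.mem_inf.2 ⟨hclosed, hsub⟩) he

theorem relRank_closed_exact_le_sum (C : DoubleComplex 𝕜 A) (k : ℕ) :
    relRank (C.closed k) (C.exact k) ≤ ∑ p ∈ Finset.range (k + 1),
      relRank (LinearMap.range (C.proj k p) ⊓ LinearMap.ker (C.delbar k)) (imDeg C.delbar k) := by
  rw [(C.isDecomposition k).relRank_eq_sum_filtration]
  exact Finset.sum_le_sum fun p _ => relRank_le_of_injective (C.proj k p)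
    (fun x hx => ⟨⟨x, rfl⟩, delbar_proj_eq_zero hx.1 hx.2⟩)
    fun x hx hm => mem_filtration_succ_sup_exact hx.1 hx.2 hm

end DoubleComplex
end DoubleComplexes

section Bidegrees

/-- The character `c ↦ c ^ p * conj c ^ q` of `ℂ`, through which complex multiplication acts on
forms of type `(p, q)`. -/
def bidegreeChar (p q : ℕ) : ℂ → ℂ := fun c => c ^ p * conj c ^ q

/-- The span of the characters of total degree `k`. -/
def bidegreeSpan (k : ℕ) : Submodule ℂ (ℂ → ℂ) :=
  Submodule.span ℂ {f | ∃ p q, p + q = k ∧ bidegreeChar p q = f}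

/-- The coefficient of `bidegreeChar p q` in a combination of the characters of degree `p + q`.
Distinct characters of this degree are orthogonal on the roots of unity of order
`2 * (p + q) + 1`. -/
def bidegreeCoeff (p q : ℕ) : (ℂ → ℂ) →ₗ[ℂ] ℂ :=
  ((2 * (p + q) + 1 : ℕ) : ℂ)⁻¹ • ∑ m ∈ Finset.range (2 * (p + q) + 1),
    let c : ℂ := Complex.exp (2 * Real.pi * Complex.I / (2 * (p + q) + 1 : ℕ)) ^ m
    conj (bidegreeChar p q c) • LinearMap.proj c

variable {p q p' q' k : ℕ} {c : ℂ} {f : ℂ → ℂ}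

lemma bidegreeChar_mem_bidegreeSpan (h : p + q = k) : bidegreeChar p q ∈ bidegreeSpan k :=
  Submodule.subset_span ⟨p, q, h, rfl⟩

lemma bidegreeChar_mul_bidegreeChar :
    bidegreeChar p q * bidegreeChar p' q' = bidegreeChar (p + p') (q + q') := by
  funext c
  simp only [bidegreeChar, Pi.mul_apply, pow_add]
  ring

lemma bidegreeChar_mul_mem (p q : ℕ) (hf : f ∈ bidegreeSpan k) :
    bidegreeChar p q * f ∈ bidegreeSpan (p + q + k) := by
  suffices bidegreeSpan k ≤
      (bidegreeSpan (p + q + k)).comap (LinearMap.mulLeft ℂ (bidegreeChar p q)) from this hf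
  refine Submodule.span_le.2 ?_
  rintro _ ⟨p', q', rfl, rfl⟩
  change bidegreeChar p q * bidegreeChar p' q' ∈ bidegreeSpan _
  rw [bidegreeChar_mul_bidegreeChar]
  exact bidegreeChar_mem_bidegreeSpan (by ring)

lemma average_zpow_pow_eq_ite {ζ : ℂ} {N : ℕ} (hζ : IsPrimitiveRoot ζ N) (hN : N ≠ 0) (j : ℤ) :
    (N : ℂ)⁻¹ * ∑ m ∈ Finset.range N, (ζ ^ j) ^ m = if (N : ℤ) ∣ j then 1 else 0 := by
  split_ifs with hj
  · rw [(hζ.zpow_eq_one_iff_dvd j).2 hj]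
    simp [hN]
  · have hone : (ζ ^ j) ^ N = 1 := by
      rw [← zpow_natCast, zpow_comm, zpow_natCast, hζ.pow_eq_one, one_zpow]
    rw [geom_sum_eq (mt (hζ.zpow_eq_one_iff_dvd j).1 hj), hone, sub_self, zero_div, mul_zero]

lemma conj_bidegreeChar_mul_bidegreeChar (hc : ‖c‖ = 1) (h : p + q = p' + q') :
    conj (bidegreeChar p q c) * bidegreeChar p' q' c = c ^ (2 * ((p' : ℤ) - p)) := by
  have hc0 : c ≠ 0 := norm_ne_zero_iff.1 (hc ▸ one_ne_zero)
  have hconj : conj c = c⁻¹ := (Complex.inv_eq_conj hc).symm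
  simp only [bidegreeChar, map_mul, map_pow, hconj, map_inv₀, inv_inv]
  simp only [← zpow_natCast, inv_zpow', ← zpow_add₀ hc0]
  congr 1
  lia

lemma bidegreeCoeff_bidegreeChar (h : p + q = p' + q') :
    bidegreeCoeff p q (bidegreeChar p' q') = if p = p' then 1 else 0 := by
  have hζ := Complex.isPrimitiveRoot_exp (2 * (p + q) + 1) (by lia)
  have hdvd : ((2 * (p + q) + 1 : ℕ) : ℤ) ∣ 2 * ((p' : ℤ) - p) ↔ p = p' := by
    refine ⟨fun hd => ?_, fun hp => by simp [hp]⟩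
    have := Int.eq_zero_of_abs_lt_dvd hd (by rw [abs_lt]; lia)
    lia
  rw [← if_congr hdvd rfl rfl, ← average_zpow_pow_eq_ite hζ (by lia)]
  simp only [bidegreeCoeff, LinearMap.smul_apply, LinearMap.sum_apply, LinearMap.proj_apply,
    smul_eq_mul]
  congr 1
  refine Finset.sum_congr rfl fun m _ => ?_
  rw [conj_bidegreeChar_mul_bidegreeChar (by rw [norm_pow, hζ.norm'_eq_one (by lia), one_pow]) h,
    ← zpow_natCast, ← zpow_natCast, zpow_comm]

lemma sum_bidegreeCoeff_smul_bidegreeChar (hf : f ∈ bidegreeSpan k) :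
    ∑ p ∈ Finset.range (k + 1), bidegreeCoeff p (k - p) f • bidegreeChar p (k - p) = f := by
  induction hf using Submodule.span_induction with
  | mem f hf =>
    obtain ⟨p, q, rfl, rfl⟩ := hf
    rw [Finset.sum_eq_single p]
    · rw [bidegreeCoeff_bidegreeChar (by lia), if_pos rfl, one_smul, Nat.add_sub_cancel_left]
    · intro r hr hrp
      have := Finset.mem_range.1 hr
      rw [bidegreeCoeff_bidegreeChar (by lia), if_neg hrp, zero_smul]
    · intro hp
      exact absurd (Finset.mem_range.2 (by lia)) hp
  | zero => simp only [map_zero, zero_smul, Finset.sum_const_zero]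
  | add f g _ _ hf hg => simp only [map_add, add_smul, Finset.sum_add_distrib, hf, hg]
  | smul a f _ hf => simp only [map_smul, smul_assoc, ← Finset.smul_sum, hf]

lemma bidegreeCoeff_comp_mul_right (hf : f ∈ bidegreeSpan (p + q)) (c : ℂ) :
    bidegreeCoeff p q (fun c' => f (c' * c)) = bidegreeChar p q c * bidegreeCoeff p q f := by
  induction hf using Submodule.span_induction with
  | mem f hf =>
    obtain ⟨p', q', h, rfl⟩ := hf
    have hmul : (fun c' => bidegreeChar p' q' (c' * c)) =
        bidegreeChar p' q' c • bidegreeChar p' q' := by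
      funext c'
      simp only [bidegreeChar, map_mul, mul_pow, Pi.smul_apply, smul_eq_mul]
      ring
    rw [hmul, map_smul, bidegreeCoeff_bidegreeChar h.symm]
    split_ifs with hp
    · obtain rfl : q = q' := by lia
      rw [hp, smul_eq_mul]
    · rw [smul_zero, mul_zero]
  | zero => exact (map_zero _).trans (by rw [map_zero, mul_zero])
  | add f g _ _ hf hg =>
    rw [map_add, mul_add, ← hf, ← hg, ← map_add]
    rfl
  | smul a f _ hf =>
    rw [map_smul, smul_eq_mul, mul_left_comm, ← hf, ← smul_eq_mul, ← map_smul]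
    rfl

lemma bidegreeCoeff_bidegreeChar_mul_eq_zero (hf : f ∈ bidegreeSpan 1)
    (h : p' + q' = p + q + 1) (hp : p' ≠ p) (hp' : p' ≠ p + 1) :
    bidegreeCoeff p' q' (bidegreeChar p q * f) = 0 := by
  suffices bidegreeSpan 1 ≤
      LinearMap.ker (bidegreeCoeff p' q' ∘ₗ LinearMap.mulLeft ℂ (bidegreeChar p q)) from this hf
  refine Submodule.span_le.2 ?_
  rintro _ ⟨r, s, hrs, rfl⟩
  change bidegreeCoeff p' q' (bidegreeChar p q * bidegreeChar r s) = 0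
  rw [bidegreeChar_mul_bidegreeChar, bidegreeCoeff_bidegreeChar (by lia), if_neg (by lia)]

end Bidegrees

section RealMultilinear
variable {V : Type*} [AddCommGroup V] [Module ℂ V]

lemma real_linear_smul (D : V →ₗ[ℝ] ℂ) (c : ℂ) (v : V) :
    D (c • v) = c * ((D v - Complex.I * D (Complex.I • v)) / 2) +
      conj c * ((D v + Complex.I * D (Complex.I • v)) / 2) := by
  have hsplit : c • v = c.re • v + c.im • (Complex.I • v) := by
    conv_lhs => rw [← Complex.re_add_im c, add_smul, mul_smul]
    simp only [Complex.coe_smul]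
  rw [hsplit, map_add, map_smul, map_smul, Complex.real_smul, Complex.real_smul,
    Complex.re_eq_add_conj, Complex.im_eq_sub_conj]
  field_simp
  linear_combination (c - conj c) * D (Complex.I • v) * Complex.I_sq

lemma real_linear_smul_mem_bidegreeSpan (D : V →ₗ[ℝ] ℂ) (v : V) :
    (fun c : ℂ => D (c • v)) ∈ bidegreeSpan 1 := by
  have hD : (fun c : ℂ => D (c • v)) =
      ((D v - Complex.I * D (Complex.I • v)) / 2) • bidegreeChar 1 0 +
        ((D v + Complex.I * D (Complex.I • v)) / 2) • bidegreeChar 0 1 := by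
    funext c
    simp only [real_linear_smul D c v, bidegreeChar, Pi.add_apply, Pi.smul_apply, smul_eq_mul]
    ring
  rw [hD]
  exact add_mem (Submodule.smul_mem _ _ (bidegreeChar_mem_bidegreeSpan rfl))
    (Submodule.smul_mem _ _ (bidegreeChar_mem_bidegreeSpan rfl))

lemma multilinear_smul_mem_bidegreeSpan {k : ℕ} (m : MultilinearMap ℝ (fun _ : Fin k => V) ℂ)
    (v : Fin k → V) : (fun c : ℂ => m (c • v)) ∈ bidegreeSpan k := by
  induction k with
  | zero =>
    have hm : (fun c : ℂ => m (c • v)) = m v • bidegreeChar 0 0 := by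
      funext c
      simp only [bidegreeChar, Subsingleton.elim (c • v) v, Pi.smul_apply, pow_zero, mul_one,
        smul_eq_mul]
    rw [hm]
    exact Submodule.smul_mem _ _ (bidegreeChar_mem_bidegreeSpan rfl)
  | succ k ih =>
    let f : ℂ → ℂ := fun c => m.curryLeft (v 0) (c • Fin.tail v)
    let g : ℂ → ℂ := fun c => m.curryLeft (Complex.I • v 0) (c • Fin.tail v)
    have hf : f ∈ bidegreeSpan k := ih _ _
    have hg : g ∈ bidegreeSpan k := ih _ _
    have hm : (fun c : ℂ => m (c • v)) =
        bidegreeChar 1 0 * ((2 : ℂ)⁻¹ • (f - Complex.I • g)) +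
          bidegreeChar 0 1 * ((2 : ℂ)⁻¹ • (f + Complex.I • g)) := by
      funext c
      have hD := real_linear_smul (m.toLinearMap (Fin.cons (v 0) (c • Fin.tail v)) 0) c (v 0)
      simp only [MultilinearMap.toLinearMap_apply, Fin.update_cons_zero] at hD
      rw [← Fin.cons_self_tail (c • v)]
      refine hD.trans ?_
      simp only [f, g, bidegreeChar, Pi.add_apply, Pi.sub_apply, Pi.mul_apply, Pi.smul_apply,
        smul_eq_mul, MultilinearMap.curryLeft_apply]
      ring
    rw [hm, add_comm k]
    exact add_mem
      (bidegreeChar_mul_mem 1 0 (Submodule.smul_mem _ _ (sub_mem hf (Submodule.smul_mem _ _ hg))))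
      (bidegreeChar_mul_mem 0 1 (Submodule.smul_mem _ _ (add_mem hf (Submodule.smul_mem _ _ hg))))

end RealMultilinear

section ExtDeriv
variable {F : Type*} [NormedAddCommGroup F] [NormedSpace ℂ F] {k p q : ℕ}

lemma extDeriv_smul_of_type {b : F → F [⋀^Fin k]→L[ℝ] ℂ} {t : F} (hb : DifferentiableAt ℝ b t)
    (htype : ∀ᶠ t' in 𝓝 t, ∀ (c : ℂ) (w : Fin k → F),
      b t' (c • w) = bidegreeChar p q c * b t' w) (u : Fin (k + 1) → F) :
    ∃ f ∈ bidegreeSpan 1, (fun c : ℂ => extDeriv b t (c • u)) = bidegreeChar p q * f := by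
  let D : Fin (k + 1) → F →L[ℝ] ℂ := fun i => fderiv ℝ (fun t' => b t' (i.removeNth u)) t
  have hD : ∀ (c : ℂ) i,
      fderiv ℝ (fun t' => b t' (i.removeNth (c • u))) t = bidegreeChar p q c • D i := by
    intro c i
    have heq : (fun t' => b t' (i.removeNth (c • u))) =ᶠ[𝓝 t]
        fun t' => bidegreeChar p q c • b t' (i.removeNth u) :=
      htype.mono fun t' ht' => ht' c (i.removeNth u)
    rw [heq.fderiv_eq]
    exact fderiv_const_smul (hb.continuousAlternatingMap_apply_const (i.removeNth u))
      (bidegreeChar p q c)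
  refine ⟨∑ i : Fin (k + 1), (-1 : ℂ) ^ (i : ℕ) • fun c : ℂ => D i (c • u i), sum_mem fun i _ =>
    Submodule.smul_mem _ _ (real_linear_smul_mem_bidegreeSpan (D i).toLinearMap (u i)), ?_⟩
  funext c
  simp only [extDeriv_apply hb, hD, Pi.mul_apply, Finset.sum_apply, Pi.smul_apply,
    Finset.mul_sum]
  refine Finset.sum_congr rfl fun i _ => ?_
  simp only [smul_apply, zsmul_eq_mul, smul_eq_mul]
  push_cast
  ring

end ExtDeriv

namespace TransverselyHolomorphicFoliation
variable {E : Type*} [NormedAddCommGroup E] [NormedSpace ℝ E]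
  {M : Type*} [TopologicalSpace M] [ChartedSpace E M]
  {F : Type*} [NormedAddCommGroup F] [NormedSpace ℂ F]
  {T : Type*} [TopologicalSpace T] [ChartedSpace F T] {ι : Type*} {k p q : ℕ}
  (𝓕 : TransverselyHolomorphicFoliation E M F T ι)

section LocalForms

lemma extChartAt_mem_localDomain {i : ι} {x : M} (hx : x ∈ 𝓕.U i) :
    extChartAt 𝓘(ℝ, E) x x ∈ 𝓕.localDomain i x (𝓕.f i x) := by
  refine ⟨mem_extChartAt_target x, ?_⟩
  rw [Set.mem_preimage, extChartAt_to_inv]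
  exact ⟨hx, mem_extChartAt_source _⟩

variable [IsManifold 𝓘(ℝ, E) ∞ M] [IsManifold 𝓘(ℂ, F) ω T]

lemma surjective_fderiv_localMap {i : ι} {x₀ : M} {t₀ : T} {y : E}
    (hy : y ∈ 𝓕.localDomain i x₀ t₀) :
    Function.Surjective (fderiv ℝ (𝓕.localMap i x₀ t₀) y) := by
  intro u
  obtain ⟨A, hA, h⟩ := 𝓕.exists_fderiv_localMap hy
  obtain ⟨u', rfl⟩ := hA.2 u
  obtain ⟨w, rfl⟩ := 𝓕.submersion_f i _ hy.2.1 u'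
  obtain ⟨v, rfl⟩ := exists_lift_chart hy.1 w
  exact ⟨v, h v⟩

lemma exists_fderiv_localMap_mfderiv_extChartAt {i : ι} {x : M} (hx : x ∈ 𝓕.U i) :
    ∃ A : F →L[ℂ] F, ∀ v : TangentSpace 𝓘(ℝ, E) x,
      fderiv ℝ (𝓕.localMap i x (𝓕.f i x)) (extChartAt 𝓘(ℝ, E) x x)
        (mfderiv 𝓘(ℝ, E) 𝓘(ℝ, E) (extChartAt 𝓘(ℝ, E) x) x v) = A (𝓕.transDeriv i x v) := by
  obtain ⟨A, hA, -⟩ := exists_complex_chartDeriv (mem_extChartAt_source (I := 𝓘(ℝ, F)) (𝓕.f i x))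
  refine ⟨A, fun v => ?_⟩
  have hf : HasMFDerivAt 𝓘(ℝ, E) 𝓘(ℝ, F) (𝓕.f i) x (𝓕.transDeriv i x) :=
    (((𝓕.smooth_f i).contMDiffAt ((𝓕.isOpen_U i).mem_nhds hx)).mdifferentiableAt
      (by simp)).hasMFDerivAt
  have hlocal : DifferentiableAt ℝ (𝓕.localMap i x (𝓕.f i x)) (extChartAt 𝓘(ℝ, E) x x) :=
    ((𝓕.contDiffOn_localMap i x (𝓕.f i x)).contDiffAt ((𝓕.isOpen_localDomain i x _).mem_nhds
      (𝓕.extChartAt_mem_localDomain hx))).differentiableAt (by simp)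
  have hchart : extChartAt 𝓘(ℝ, F) (𝓕.f i x) ∘ 𝓕.f i =ᶠ[𝓝 x]
      𝓕.localMap i x (𝓕.f i x) ∘ extChartAt 𝓘(ℝ, E) x :=
    Filter.eventuallyEq_of_mem (extChartAt_source_mem_nhds x) fun z hz =>
      congrArg (extChartAt 𝓘(ℝ, F) (𝓕.f i x) ∘ 𝓕.f i) ((extChartAt 𝓘(ℝ, E) x).left_inv hz).symm
  have hcomp := hlocal.hasFDerivAt.hasMFDerivAt.comp x
    (mdiff_chart (mem_extChartAt_source x)).hasMFDerivAt
  exact DFunLike.congr_fun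
    (hasMFDerivAt_unique (hcomp.congr_of_eventuallyEq hchart) (hA.comp x hf)) v

lemma local_form_smul {α : 𝓕.basicForms k} (hα : α ∈ 𝓕.typeForms k p q) {i : ι}
    {x₀ : M} {t₀ : T} {y : E} (hy : y ∈ 𝓕.localDomain i x₀ t₀) {b : F [⋀^Fin k]→L[ℝ] ℂ}
    (hb : chartRep x₀ α.1 y = b.compContinuousLinearMap (fderiv ℝ (𝓕.localMap i x₀ t₀) y))
    (c : ℂ) (w : Fin k → F) : b (c • w) = bidegreeChar p q c * b w := by
  obtain ⟨A, hA, h⟩ := 𝓕.exists_fderiv_localMap hy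
  have hb' (v : Fin k → E) :
      chartRep x₀ α.1 y v = b fun j => fderiv ℝ (𝓕.localMap i x₀ t₀) y (v j) := by rw [hb]; rfl
  choose v hv using fun j => 𝓕.surjective_fderiv_localMap hy (w j)
  choose v' hv' using fun j => 𝓕.surjective_fderiv_localMap hy (c • w j)
  have hw : b w = chartRep x₀ α.1 y v := by rw [hb', funext hv]
  have hcw : b (c • w) = chartRep x₀ α.1 y v' := by rw [hb', funext hv']; rfl
  rw [hw, hcw]
  refine hα c i _ hy.2.1 _ _ fun j => hA.1 ?_
  refine ((h (v' j)).symm.trans (hv' j)).trans ?_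
  rw [A.map_smul]
  exact congrArg (c • ·) ((h (v j)).symm.trans (hv j)).symm

variable [FiniteDimensional ℝ E] [FiniteDimensional ℂ F]

lemma exists_d_apply_eq_extDeriv {α : 𝓕.basicForms k} (hα : α ∈ 𝓕.typeForms k p q) {i : ι}
    {x : M} (hx : x ∈ 𝓕.U i) :
    ∃ (b : F → F [⋀^Fin k]→L[ℝ] ℂ) (t : F) (A : F →L[ℂ] F), DifferentiableAt ℝ b t ∧
      (∀ᶠ t' in 𝓝 t, ∀ (c : ℂ) (w : Fin k → F), b t' (c • w) = bidegreeChar p q c * b t' w) ∧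
      ∀ v, (𝓕.d k α).1 x v = extDeriv b t fun j => A (𝓕.transDeriv i x (v j)) := by
  have : FiniteDimensional ℝ F := FiniteDimensional.complexToReal F
  have : CompleteSpace E := FiniteDimensional.complete ℝ E
  have : CompleteSpace F := FiniteDimensional.complete ℝ F
  have hdom := 𝓕.extChartAt_mem_localDomain hx
  obtain ⟨A, hA⟩ := 𝓕.exists_fderiv_localMap_mfderiv_extChartAt hx
  set y₀ := extChartAt 𝓘(ℝ, E) x x
  set g := 𝓕.localMap i x (𝓕.f i x)
  obtain ⟨b, V, W, hV, hW, hyW, hsub, hmaps, hb, hrep⟩ := 𝓕.exists_local_form α hdom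
  have hWy₀ : W ∈ 𝓝 y₀ := hW.mem_nhds hyW
  have hg : ContDiffAt ℝ ∞ g y₀ := ((𝓕.contDiffOn_localMap i x _).mono hsub).contDiffAt hWy₀
  have hbd : DifferentiableAt ℝ b (g y₀) :=
    (hb.contDiffAt (hV.mem_nhds (hmaps hyW))).differentiableAt (by simp)
  refine ⟨b, g y₀, A, hbd, ?_, fun v => ?_⟩
  · have hstrict : HasStrictFDerivAt g (fderiv ℝ g y₀) y₀ := hg.hasStrictFDerivAt (by simp)
    rw [← hstrict.map_nhds_eq_of_surj
      (LinearMap.range_eq_top.2 (𝓕.surjective_fderiv_localMap hdom)), Filter.eventually_map]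
    filter_upwards [hWy₀] with y hy
    exact 𝓕.local_form_smul hα (hsub hy) (hrep y hy)
  · have hpullback : extDeriv (chartRep x α.1) y₀ =
        (extDeriv b (g y₀)).compContinuousLinearMap (fderiv ℝ g y₀) := by
      rw [(Filter.eventuallyEq_of_mem hWy₀ hrep).extDeriv_eq,
        extDeriv_pullback (r := ∞) hbd hg minSmoothness_two_le]
    exact (congrArg (fun B : E [⋀^Fin (k + 1)]→L[ℝ] ℂ => B fun j =>
      mfderiv 𝓘(ℝ, E) 𝓘(ℝ, E) (extChartAt 𝓘(ℝ, E) x) x (v j)) hpullback).trans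
      (congrArg (extDeriv b (g y₀)) (funext fun j => hA (v j)))

end LocalForms

variable [IsManifold 𝓘(ℝ, E) ∞ M] [IsManifold 𝓘(ℂ, F) ω T] [FiniteDimensional ℝ E]
  [FiniteDimensional ℂ F]

section TypeDecomposition

lemma scale_mem_bidegreeSpan (α : 𝓕.basicForms k) (x : M)
    (v : Fin k → TangentSpace 𝓘(ℝ, E) x) :
    (fun c => (𝓕.scale k c α).1 x v) ∈ bidegreeSpan k := by
  obtain ⟨i, hi⟩ := 𝓕.cover x
  obtain ⟨R, hR⟩ := (𝓕.transDeriv i x).toLinearMap.exists_rightInverse_of_surjective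
    (LinearMap.range_eq_top.2 (𝓕.submersion_f i x hi))
  convert multilinear_smul_mem_bidegreeSpan
    ((α.1 x).toMultilinearMap.compLinearMap fun _ => R) (fun j => 𝓕.transDeriv i x (v j)) using 2
  exact 𝓕.scale_apply _ α hi fun j => LinearMap.congr_fun hR _

lemma typeProj_apply (h : p + q = k) (α : 𝓕.basicForms k) (x : M)
    (v : Fin k → TangentSpace 𝓘(ℝ, E) x) :
    (𝓕.typeProj k p q α).1 x v = bidegreeCoeff p q fun c => (𝓕.scale k c α).1 x v := by
  subst h
  let ev : 𝓕.basicForms (p + q) →ₗ[ℂ] ℂ :=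
    { toFun := fun β => β.1 x v
      map_add' := fun _ _ => rfl
      map_smul' := fun _ _ => rfl }
  change ev _ = bidegreeCoeff p q fun c => ev (𝓕.scale _ c α)
  rw [typeProj, if_pos rfl]
  simp only [bidegreeCoeff, LinearMap.smul_apply, LinearMap.sum_apply, map_smul, map_sum,
    LinearMap.proj_apply]
  rfl

lemma sum_typeProj (α : 𝓕.basicForms k) :
    ∑ p ∈ Finset.range (k + 1), 𝓕.typeProj k p (k - p) α = α := by
  refine Subtype.ext (funext fun x => ContinuousAlternatingMap.ext fun v => ?_)
  let ev : 𝓕.basicForms k →ₗ[ℂ] ℂ :=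
    { toFun := fun β => β.1 x v
      map_add' := fun _ _ => rfl
      map_smul' := fun _ _ => rfl }
  obtain ⟨i, hi⟩ := 𝓕.cover x
  have hone : (𝓕.scale k 1 α).1 x v = ev α := 𝓕.scale_apply 1 α hi fun j => (one_smul ℂ _).symm
  have hsum := congrFun (sum_bidegreeCoeff_smul_bidegreeChar (𝓕.scale_mem_bidegreeSpan α x v)) 1
  change ev _ = ev α
  rw [map_sum, ← hone, ← hsum, Finset.sum_apply]
  refine Finset.sum_congr rfl fun p hp => ?_
  have := Finset.mem_range.1 hp
  refine (𝓕.typeProj_apply (by lia) α x v).trans ?_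
  simp [bidegreeChar]

lemma typeProj_mem_typeForms (h : p + q = k) (α : 𝓕.basicForms k) :
    𝓕.typeProj k p q α ∈ 𝓕.typeForms k p q := by
  subst h
  intro c i x hx v w hvw
  rw [𝓕.typeProj_apply rfl, 𝓕.typeProj_apply rfl]
  refine Eq.trans ?_ (bidegreeCoeff_comp_mul_right (𝓕.scale_mem_bidegreeSpan α x v) c)
  congr 1
  funext c'
  refine (𝓕.scale_apply (c' * c) α hx fun j => ?_).symm
  rw [mul_smul, ← hvw]
  exact 𝓕.transDeriv_lift c' hx (w j)

lemma range_typeProj (h : p + q = k) :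
    LinearMap.range (𝓕.typeProj k p q) = 𝓕.typeForms k p q := by
  refine le_antisymm ?_ fun α hα => ⟨α, ?_⟩
  · rintro _ ⟨α, rfl⟩
    exact 𝓕.typeProj_mem_typeForms h α
  · rw [𝓕.typeProj_of_mem h h hα, if_pos rfl]

lemma typeProj_d_eq_zero {r s : ℕ} (h : r + s = p + q + 1) (hr : r ≠ p) (hr' : r ≠ p + 1)
    {α : 𝓕.basicForms (p + q)} (hα : α ∈ 𝓕.typeForms (p + q) p q) :
    𝓕.typeProj (p + q + 1) r s (𝓕.d (p + q) α) = 0 := by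
  refine Subtype.ext (funext fun x => ContinuousAlternatingMap.ext fun v => ?_)
  obtain ⟨i, hi⟩ := 𝓕.cover x
  obtain ⟨b, t, A, hb, htype, hd⟩ := 𝓕.exists_d_apply_eq_extDeriv hα hi
  obtain ⟨f, hf, hbf⟩ := extDeriv_smul_of_type hb htype fun j => A (𝓕.transDeriv i x (v j))
  refine (𝓕.typeProj_apply h _ x v).trans ?_
  refine Eq.trans ?_ (bidegreeCoeff_bidegreeChar_mul_eq_zero hf h hr hr')
  rw [← hbf]
  congr 1
  funext c
  refine (hd fun j => 𝓕.lift c x (v j)).trans (congrArg (extDeriv b t) (funext fun j => ?_))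
  rw [𝓕.transDeriv_lift c hi, map_smul]
  rfl

lemma typeProj_of_lt (hp : k < p) : 𝓕.typeProj k p q = 0 := by
  rw [typeProj, if_neg (by lia)]

lemma isDecomposition_typeProj (k : ℕ) :
    IsDecomposition (fun p => 𝓕.typeProj k p (k - p)) (k + 1) where
  proj_proj p q α := by
    rcases lt_or_ge k q with hq | hq
    · simp only [𝓕.typeProj_of_lt hq, LinearMap.zero_apply, map_zero]
      split_ifs with hpq
      · rw [hpq, 𝓕.typeProj_of_lt hq, LinearMap.zero_apply]
      · rfl
    rcases lt_or_ge k p with hp | hp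
    · rw [𝓕.typeProj_of_lt hp, LinearMap.zero_apply, LinearMap.zero_apply, ite_self]
    rw [𝓕.typeProj_of_mem (by lia) (by lia) (𝓕.typeProj_mem_typeForms (q := k - q) (by lia) α)]
    split_ifs with hpq
    · rw [hpq]
    · rfl
  sum_proj := 𝓕.sum_typeProj

lemma typeProj_d_typeProj_eq_zero {r : ℕ} (hr : r ≠ p) (hr' : r ≠ p + 1) (α : 𝓕.basicForms k) :
    𝓕.typeProj (k + 1) r (k + 1 - r) (𝓕.d k (𝓕.typeProj k p (k - p) α)) = 0 := by
  rcases lt_or_ge k p with hp | hp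
  · rw [𝓕.typeProj_of_lt hp, LinearMap.zero_apply, map_zero, map_zero]
  rcases lt_or_ge (k + 1) r with hr₁ | hr₁
  · rw [𝓕.typeProj_of_lt hr₁, LinearMap.zero_apply]
  obtain ⟨q, rfl⟩ := Nat.exists_eq_add_of_le hp
  rw [Nat.add_sub_cancel_left]
  exact 𝓕.typeProj_d_eq_zero (by lia) hr hr' (𝓕.typeProj_mem_typeForms rfl α)

end TypeDecomposition

section DolbeaultComplex

/-- The double complex of basic forms, with the type projections as bidegree projections. -/
def dolbeaultComplex : DoubleComplex ℂ (fun k => 𝓕.basicForms k) :=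
  DoubleComplex.ofDifferential 𝓕.d 𝓕.del 𝓕.delbar (fun k p => 𝓕.typeProj k p (k - p))
    𝓕.isDecomposition_typeProj
    (fun _ α => Subtype.ext (extDerivForm_extDerivForm α.2.1))
    (fun _ _ _ α hr hr' => 𝓕.typeProj_d_typeProj_eq_zero hr hr' α)
    (fun k => by
      rw [del, Finset.Nat.sum_antidiagonal_eq_sum_range_succ_mk]
      simp only [shiftPart, Nat.add_sub_add_right])
    (fun k => by
      rw [delbar, Finset.Nat.sum_antidiagonal_eq_sum_range_succ_mk, shiftPart]
      refine Finset.sum_congr rfl fun p hp => ?_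
      rw [add_zero, Nat.succ_sub (Nat.lt_succ_iff.1 (Finset.mem_range.1 hp))])

lemma imD_eq_exact (k : ℕ) : 𝓕.imD k = 𝓕.dolbeaultComplex.exact k := by
  cases k <;> rfl

lemma imDel_eq_imDeg (k : ℕ) : 𝓕.imDel k = imDeg 𝓕.del k := by
  cases k <;> rfl

lemma imDelbar_eq_imDeg (k : ℕ) : 𝓕.imDelbar k = imDeg 𝓕.delbar k := by
  cases k <;> rfl

lemma imDelDelbar_eq (k : ℕ) : 𝓕.imDelDelbar k = 𝓕.dolbeaultComplex.imDelDelbar k :=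
  match k with
  | 0 => rfl
  | 1 => (Submodule.map_bot _).symm
  | _ + 2 => LinearMap.range_comp _ _

lemma satisfiesDelDelbarLemma_iff : 𝓕.SatisfiesDelDelbarLemma ↔
    ∀ k, 𝓕.dolbeaultComplex.bottChernCycles k ⊓ 𝓕.dolbeaultComplex.exact k =
      𝓕.dolbeaultComplex.imDelDelbar k := by
  refine forall_congr' fun k => ?_
  rw [← 𝓕.imD_eq_exact, ← 𝓕.imDelDelbar_eq]
  rfl

lemma rank_basicCohomology (k : ℕ) : Module.rank ℂ (𝓕.BasicCohomology k) =
    relRank (𝓕.dolbeaultComplex.closed k) (𝓕.dolbeaultComplex.exact k) := by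
  rw [← 𝓕.imD_eq_exact]
  rfl

lemma rank_dolbeaultCohomology (hk : p + q = k) : Module.rank ℂ (𝓕.DolbeaultCohomology p q) =
    relRank (LinearMap.range (𝓕.dolbeaultComplex.proj k p) ⊓
      LinearMap.ker (𝓕.dolbeaultComplex.delbar k)) (imDeg 𝓕.dolbeaultComplex.delbar k) := by
  subst hk
  change _ = relRank (LinearMap.range (𝓕.typeProj (p + q) p (p + q - p)) ⊓ _) (imDeg 𝓕.delbar _)
  rw [Nat.add_sub_cancel_left, 𝓕.range_typeProj rfl, ← 𝓕.imDelbar_eq_imDeg]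
  rfl

lemma rank_bottChernCohomology (hk : p + q = k) : Module.rank ℂ (𝓕.BottChernCohomology p q) =
    relRank (LinearMap.range (𝓕.dolbeaultComplex.proj k p) ⊓
      𝓕.dolbeaultComplex.bottChernCycles k) (𝓕.dolbeaultComplex.imDelDelbar k) := by
  subst hk
  change _ = relRank (LinearMap.range (𝓕.typeProj (p + q) p (p + q - p)) ⊓ _) _
  rw [Nat.add_sub_cancel_left, 𝓕.range_typeProj rfl, ← 𝓕.imDelDelbar_eq]
  rfl

lemma rank_aeppliCohomology (hk : p + q = k) : Module.rank ℂ (𝓕.AeppliCohomology p q) =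
    relRank (LinearMap.range (𝓕.dolbeaultComplex.proj k p) ⊓ 𝓕.dolbeaultComplex.aeppliCycles k)
      (𝓕.dolbeaultComplex.aeppliBoundaries k) := by
  subst hk
  change _ = relRank (LinearMap.range (𝓕.typeProj (p + q) p (p + q - p)) ⊓ _)
    (imDeg 𝓕.del _ ⊔ imDeg 𝓕.delbar _)
  rw [Nat.add_sub_cancel_left, 𝓕.range_typeProj rfl, ← 𝓕.imDel_eq_imDeg, ← 𝓕.imDelbar_eq_imDeg]
  rfl

lemma sum_rank_bottChern_add_aeppli (k : ℕ) :
    ∑ pq ∈ Finset.HasAntidiagonal.antidiagonal k,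
        (Module.rank ℂ (𝓕.BottChernCohomology pq.1 pq.2) +
          Module.rank ℂ (𝓕.AeppliCohomology pq.1 pq.2)) =
      relRank (𝓕.dolbeaultComplex.bottChernCycles k) (𝓕.dolbeaultComplex.imDelDelbar k) +
        relRank (𝓕.dolbeaultComplex.aeppliCycles k) (𝓕.dolbeaultComplex.aeppliBoundaries k) := by
  rw [DoubleComplex.relRank_bottChern_eq_sum, DoubleComplex.relRank_aeppli_eq_sum,
    ← Finset.sum_add_distrib, Finset.Nat.sum_antidiagonal_eq_sum_range_succ_mk]
  refine Finset.sum_congr rfl fun p hp => ?_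
  have hk : p + (k - p) = k := Nat.add_sub_of_le (Nat.lt_succ_iff.1 (Finset.mem_range.1 hp))
  rw [𝓕.rank_bottChernCohomology hk, 𝓕.rank_aeppliCohomology hk]

lemma finiteDimensional_basicCohomology
    (hfin : ∀ p q, FiniteDimensional ℂ (𝓕.DolbeaultCohomology p q)) (k : ℕ) :
    FiniteDimensional ℂ (𝓕.BasicCohomology k) := by
  rw [FiniteDimensional, ← Module.rank_lt_aleph0_iff, rank_basicCohomology]
  refine (DoubleComplex.relRank_closed_exact_le_sum _ k).trans_lt
    (Finset.sum_induction _ (· < Cardinal.aleph0) (fun _ _ => Cardinal.add_lt_aleph0)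
      Cardinal.aleph0_pos fun p hp => ?_)
  have hk : p + (k - p) = k := Nat.add_sub_of_le (Nat.lt_succ_iff.1 (Finset.mem_range.1 hp))
  have := hfin p (k - p)
  rw [← 𝓕.rank_dolbeaultCohomology hk]
  exact Module.rank_lt_aleph0 ℂ _

end DolbeaultComplex
end TransverselyHolomorphicFoliation

end BasicForms
end

theorem mainTheorem1_general
    {E : Type*} [NormedAddCommGroup E] [NormedSpace ℝ E] [FiniteDimensional ℝ E]
    {M : Type*} [TopologicalSpace M] [ChartedSpace E M] [IsManifold 𝓘(ℝ, E) ∞ M]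
    {F : Type*} [NormedAddCommGroup F] [NormedSpace ℂ F] [FiniteDimensional ℂ F]
    {T : Type*} [TopologicalSpace T] [ChartedSpace F T] [IsManifold 𝓘(ℂ, F) ω T]
    {ι : Type*} (𝓕 : BasicForms.TransverselyHolomorphicFoliation E M F T ι) :
    (∀ k : ℕ, 2 * Module.rank ℂ (𝓕.BasicCohomology k) ≤
      ∑ pq ∈ Finset.HasAntidiagonal.antidiagonal k,
        (Module.rank ℂ (𝓕.BottChernCohomology pq.1 pq.2) +
          Module.rank ℂ (𝓕.AeppliCohomology pq.1 pq.2))) ∧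
    (𝓕.SatisfiesDelDelbarLemma → ∀ k : ℕ, ∑ pq ∈ Finset.HasAntidiagonal.antidiagonal k,
        (Module.rank ℂ (𝓕.BottChernCohomology pq.1 pq.2) +
          Module.rank ℂ (𝓕.AeppliCohomology pq.1 pq.2)) =
        2 * Module.rank ℂ (𝓕.BasicCohomology k)) ∧
    ((∀ k : ℕ, FiniteDimensional ℂ (𝓕.BasicCohomology k)) →
      (∀ k : ℕ, ∑ pq ∈ Finset.HasAntidiagonal.antidiagonal k,
        (Module.rank ℂ (𝓕.BottChernCohomology pq.1 pq.2) +
          Module.rank ℂ (𝓕.AeppliCohomology pq.1 pq.2)) =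
        2 * Module.rank ℂ (𝓕.BasicCohomology k)) →
      𝓕.SatisfiesDelDelbarLemma) := by
  simp only [𝓕.sum_rank_bottChern_add_aeppli, FiniteDimensional, ← Module.rank_lt_aleph0_iff,
    𝓕.rank_basicCohomology, 𝓕.satisfiesDelDelbarLemma_iff]
  exact ⟨𝓕.dolbeaultComplex.two_mul_relRank_closed_exact_le,
    BasicForms.DoubleComplex.relRank_bottChern_add_relRank_aeppli_of_inf_eq,
    BasicForms.DoubleComplex.inf_eq_of_relRank_bottChern_add_relRank_aeppli⟩

theorem mainTheorem1 {n r : ℕ}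
    {M : Type*} [TopologicalSpace M] [T2Space M] [SecondCountableTopology M]
    [ChartedSpace (EuclideanSpace ℝ (Fin n)) M] [IsManifold 𝓘(ℝ, EuclideanSpace ℝ (Fin n)) ∞ M]
    {T : Type*} [TopologicalSpace T]
    [ChartedSpace (EuclideanSpace ℂ (Fin r)) T] [IsManifold 𝓘(ℂ, EuclideanSpace ℂ (Fin r)) ω T]
    {ι : Type*}
    (𝓕 : BasicForms.TransverselyHolomorphicFoliation
      (EuclideanSpace ℝ (Fin n)) M (EuclideanSpace ℂ (Fin r)) T ι)
    (hfin : ∀ p q : ℕ, FiniteDimensional ℂ (𝓕.DolbeaultCohomology p q)) :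
    (∀ k : ℕ, 2 * Module.rank ℂ (𝓕.BasicCohomology k) ≤
      ∑ pq ∈ Finset.HasAntidiagonal.antidiagonal k,
        (Module.rank ℂ (𝓕.BottChernCohomology pq.1 pq.2) +
          Module.rank ℂ (𝓕.AeppliCohomology pq.1 pq.2))) ∧
    ((∀ k : ℕ, ∑ pq ∈ Finset.HasAntidiagonal.antidiagonal k,
        (Module.rank ℂ (𝓕.BottChernCohomology pq.1 pq.2) +
          Module.rank ℂ (𝓕.AeppliCohomology pq.1 pq.2)) =
        2 * Module.rank ℂ (𝓕.BasicCohomology k)) ↔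
      𝓕.SatisfiesDelDelbarLemma) := by
  obtain ⟨hle, hlemma, heq⟩ := mainTheorem1_general 𝓕
  exact ⟨hle, heq (𝓕.finiteDimensional_basicCohomology hfin), hlemma⟩
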